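/- Let $n \geq 2$, and let $\mathfrak{C}_n = \{0,1,\dots,n-1\}^{\mathbb{N}}$ be the $n$-ary Cantor space. A finite set $A$ of finite words over $\{0,1,\dots,n-1\}$ is a \emph{basis} if the cones $u\mathfrak{C}_n = \{uw : w \in \mathfrak{C}_n\}$, $u \in A$, partition $\mathfrak{C}_n$. The \emph{Higman--Thompson group} $V_n$ is the group of all bijections $g$ of $\mathfrak{C}_n$ for which there are bases $A$, $B$ and a bijection $\sigma\colon A \to B$ such that $g$ maps $uw$ to $\sigma(u)w$ for all $u \in A$ and $w \in \mathfrak{C}_n$; such a triple $(A,\sigma,B)$ is a \emph{basis pair} for $g$. Let $V_n'$ be the derived subgroup of $V_n$. A group is \emph{$\frac32$-generated} if it has a generating set of size two and every nontrivial element is contained in a generating set of size two. Then $V_n$ and $V_n'$ are $\frac32$-generated. Moreover, let $G$ be either $V_n$ or $V_n'$. For every nontrivial $g \in G$, there is an element $h \in G$ with $h \neq g$ and $\langle g, h\rangle = G$ such that $h$ has finite order and is a product of disjoint cycles of pairwise coprime orders; that is, $h$ has a basis pair $(A,\sigma,A)$ such that any two distinct cycles in the disjoint cycle decomposition of the permutation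 $\sigma$ of $A$ have coprime orders. In particular, if $n$ is odd, then $V_n$ is an infinite noncyclic $\frac32$-generated group that is not simple. -/

import Mathlib

namespace HigmanThompson

/-- The `n`-ary Cantor space: infinite sequences over `{0, 1, …, n - 1}`. -/
abbrev Cantor (n : ℕ) : Type := ℕ → Fin n

/-- Finite words over `{0, 1, …, n - 1}`. -/
abbrev Word (n : ℕ) : Type := List (Fin n)

/-- The concatenation `u w` of a finite word `u` and an infinite sequence `w`. -/
def app {n : ℕ} (u : Word n) (w : Cantor n) : Cantor n :=
  fun k => if h : k < u.length then u[k] else w (k - u.length)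

/-- The cone of all infinite sequences with prefix `u`. -/
def cone {n : ℕ} (u : Word n) : Set (Cantor n) := Set.range (app u)

/-- A finite set of words is a basis if its cones partition the Cantor space. -/
def IsBasis {n : ℕ} (A : Finset (Word n)) : Prop :=
  ∀ x : Cantor n, ∃! u : Word n, u ∈ A ∧ x ∈ cone u

/-- `(A, σ, B)` is a basis pair for the bijection `g`: both `A` and `B` are bases, and `g`
maps `u w` to `σ(u) w` for all `u ∈ A` and all infinite sequences `w`. -/
def IsBasisPair {n : ℕ} (g : Equiv.Perm (Cantor n)) (A B : Finset (Word n)) (σ : A ≃ B) : Prop :=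
  IsBasis A ∧ IsBasis B ∧ ∀ (u : A) (w : Cantor n), g (app u.1 w) = app (σ u).1 w

theorem app_nil {n : ℕ} (w : Cantor n) : app [] w = w := by
  funext k
  simp [app]

theorem app_append {n : ℕ} (u v : Word n) (w : Cantor n) : app (u ++ v) w = app u (app v w) := by
  funext k
  simp only [app, List.length_append, List.getElem_append]
  split_ifs <;> first | rfl | omega | (congr 1; omega)

theorem app_take_drop {n : ℕ} (N : ℕ) (x : Cantor n) :
    app (List.ofFn fun i : Fin N => x i) (fun k => x (k + N)) = x := by
  funext k
  by_cases h : k < N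
  · simp [app, h]
  · simp only [app, List.length_ofFn, h, dite_false]
    congr 1
    omega

theorem app_left_inj {n : ℕ} {u v : Word n} (hl : u.length = v.length) {w z : Cantor n}
    (h : app u w = app v z) : u = v := by
  apply List.ext_getElem hl
  intro i h1 h2
  have := congrFun h i
  simpa [app, h1, h2] using this

theorem isBasis_nil {n : ℕ} : IsBasis ({[]} : Finset (Word n)) := by
  intro x
  refine ⟨[], ⟨by simp, x, app_nil x⟩, ?_⟩
  rintro u ⟨hu, -⟩
  simpa using hu

/-- A word that is at most as long as `u` and whose cone meets that of `u` is a prefix of `u`. -/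
theorem prefix_of_app_eq {n : ℕ} {a u : Word n} (hl : a.length ≤ u.length) {w z : Cantor n}
    (h : app a w = app u z) : ∃ t, u = a ++ t := by
  refine ⟨u.drop a.length, ?_⟩
  have h1 : a = u.take a.length := by
    rw [← List.take_append_drop a.length u, app_append] at h
    exact app_left_inj (by simp [hl]) h
  conv_lhs => rw [← List.take_append_drop a.length u]
  rw [← h1]

/-- The set of all words of length `N` is a basis. -/
def level (n N : ℕ) : Finset (Word n) :=
  (Finset.univ : Finset (Fin N → Fin n)).image List.ofFn

theorem mem_level {n N : ℕ} {u : Word n} : u ∈ level n N ↔ u.length = N := by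
  constructor
  · intro h
    obtain ⟨f, -, rfl⟩ := Finset.mem_image.1 h
    simp
  · rintro rfl
    exact Finset.mem_image.2 ⟨fun i => u[i], Finset.mem_univ _, by simp⟩

theorem isBasis_level (n N : ℕ) : IsBasis (level n N) := by
  intro x
  refine ⟨List.ofFn fun i : Fin N => x i, ⟨mem_level.2 (by simp), _, app_take_drop N x⟩, ?_⟩
  rintro u ⟨hu, w, hw⟩
  rw [mem_level] at hu
  exact app_left_inj (by simp [hu]) (hw.trans (app_take_drop N x).symm)

/-- A bijection has a basis pair if and only if, for some `N`, it acts by a prefix replacement on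
the cone of each word of length `N`. -/
theorem exists_isBasisPair_iff {n : ℕ} (g : Equiv.Perm (Cantor n)) :
    (∃ (A B : Finset (Word n)) (σ : A ≃ B), IsBasisPair g A B σ) ↔
      ∃ N : ℕ, ∀ u : Word n, u.length = N → ∃ v : Word n, ∀ w, g (app u w) = app v w := by
  classical
  constructor
  · rintro ⟨A, B, σ, hA, -, hσ⟩
    refine ⟨A.sup List.length, fun u hu => ?_⟩
    rcases isEmpty_or_nonempty (Cantor n) with hE | ⟨⟨w0⟩⟩
    · exact ⟨[], fun w => (hE.false w).elim⟩
    obtain ⟨a, ⟨ha, z, hz⟩, -⟩ := hA (app u w0)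
    obtain ⟨t, rfl⟩ := prefix_of_app_eq (hu ▸ Finset.le_sup (f := List.length) ha) hz
    refine ⟨(σ ⟨a, ha⟩).1 ++ t, fun w => ?_⟩
    rw [app_append, app_append]
    exact hσ ⟨a, ha⟩ _
  · rintro ⟨N, hN⟩
    rcases isEmpty_or_nonempty (Cantor n) with hE | ⟨⟨w0⟩⟩
    · exact ⟨{[]}, {[]}, Equiv.refl _, isBasis_nil, isBasis_nil,
        fun _ w => (hE.false w).elim⟩
    choose f hf using hN
    let F : level n N → Word n := fun u => f u.1 (mem_level.1 u.2)
    have hF : ∀ (u : level n N) (w : Cantor n), g (app u.1 w) = app (F u) w :=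
      fun u w => hf u.1 (mem_level.1 u.2) w
    have key : ∀ (u v : level n N) (w z : Cantor n), app (F u) w = app (F v) z → u = v := by
      intro u v w z h
      rw [← hF, ← hF] at h
      exact Subtype.ext (app_left_inj
        ((mem_level.1 u.2).trans (mem_level.1 v.2).symm) (g.injective h))
    have hinj : Function.Injective F := fun u v h => key u v w0 w0 (by rw [h])
    let B : Finset (Word n) := Finset.univ.image F
    have hB : ∀ u, F u ∈ B := fun u => Finset.mem_image_of_mem F (Finset.mem_univ u)
    let σ : level n N ≃ B := Equiv.ofBijective (fun u => ⟨F u, hB u⟩)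
      ⟨fun u v h => hinj (congrArg Subtype.val h), fun ⟨b, hb⟩ => by
        obtain ⟨u, -, rfl⟩ := Finset.mem_image.1 hb
        exact ⟨u, rfl⟩⟩
    refine ⟨level n N, B, σ, isBasis_level n N, fun x => ?_, hF⟩
    obtain ⟨u, ⟨hu, w, hw⟩, -⟩ := isBasis_level n N (g.symm x)
    have hx : app (F ⟨u, hu⟩) w = x := by
      rw [← hF, hw, Equiv.apply_symm_apply]
    refine ⟨F ⟨u, hu⟩, ⟨hB _, w, hx⟩, ?_⟩
    rintro b ⟨hb, z, hz⟩
    obtain ⟨v, -, rfl⟩ := Finset.mem_image.1 hb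
    rw [key v ⟨u, hu⟩ z w (hz.trans hx.symm)]

/-- The Higman–Thompson group `V_n`: the bijections of the `n`-ary Cantor space that have a basis
pair. -/
def V (n : ℕ) : Subgroup (Equiv.Perm (Cantor n)) where
  carrier := {g | ∃ (A B : Finset (Word n)) (σ : A ≃ B), IsBasisPair g A B σ}
  one_mem' := ⟨{[]}, {[]}, Equiv.refl _, isBasis_nil, isBasis_nil, fun _ _ => rfl⟩
  inv_mem' := by
    rintro g ⟨A, B, σ, hA, hB, hσ⟩
    refine ⟨B, A, σ.symm, hB, hA, fun u w => ?_⟩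
    rw [Equiv.Perm.inv_eq_iff_eq, hσ, Equiv.apply_symm_apply]
  mul_mem' := by
    intro g h hg hh
    obtain ⟨M, hM⟩ := (exists_isBasisPair_iff g).1 hg
    obtain ⟨N, hN⟩ := (exists_isBasisPair_iff h).1 hh
    refine (exists_isBasisPair_iff (g * h)).2 ⟨N + M, fun u hu => ?_⟩
    obtain ⟨v, hv⟩ := hN (u.take N) (by simp [hu])
    obtain ⟨v', hv'⟩ := hM ((v ++ u.drop N).take M) (by simp [hu])
    refine ⟨v' ++ (v ++ u.drop N).drop M, fun w => ?_⟩
    rw [Equiv.Perm.mul_apply, app_append, ← hv', ← app_append, List.take_append_drop,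
      app_append, ← hv, ← app_append, List.take_append_drop]

/-- `h` is a product of disjoint cycles of pairwise coprime orders: it permutes the cones of a
basis `A` by prefix replacement according to a permutation `σ` of `A`, and any two distinct cycles
in the disjoint cycle decomposition of `σ` have coprime orders. -/
def IsCoprimeCycleProduct {n : ℕ} (h : Equiv.Perm (Cantor n)) : Prop :=
  ∃ (A : Finset (Word n)) (σ : Equiv.Perm A), IsBasisPair h A A σ ∧
    ∀ c ∈ σ.cycleFactorsFinset, ∀ d ∈ σ.cycleFactorsFinset, c ≠ d →
      Nat.Coprime (orderOf c) (orderOf d)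

end HigmanThompson

/-- A group is `d`-generated if it has a generating set of size `d`. -/
def IsDGenerated (d : ℕ) (G : Type*) [Group G] : Prop :=
  ∃ S : Finset G, S.card = d ∧ Subgroup.closure (S : Set G) = ⊤

/-- A group is `3/2`-generated if it is `2`-generated and every nontrivial element is contained in
a generating pair. -/
def IsThreeHalvesGenerated (G : Type*) [Group G] : Prop :=
  IsDGenerated 2 G ∧ ∀ g : G, g ≠ 1 → ∃ h : G, h ≠ g ∧ Subgroup.closure {g, h} = ⊤

/-! The groups behave like alternating and symmetric groups acting on cones. `V n` is generated by
the transpositions of disjoint cones (`V_le_of_swapIn`), and modulo the three-cycles of small cones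
all transpositions of small cones coincide. Hence a subgroup containing the three-cycles of all
sufficiently small cones contains the derived subgroup (`derivedV_le_of_triIn`), and one
transposition of small cones more gives all of `V n`.

Let `g` be nontrivial. It sends some cone `d` to a cone `d'` disjoint from it, and some cone `e` to
`e'` with `e` and `e'` both disjoint from `d`. Let `A` be the words of a fixed large length that are
not below `d`. The element `h` is a product of disjoint cycles: a cycle `y` on most of `A`, and,
inside the cone of `d`, a three-cycle `x`, a cycle `z` whose length is a power of five, and
optionally a transposition. The lengths are pairwise coprime, so each cycle is a power of `h` and
lies in `H = ⟨g, h⟩` (`mem_of_list_prod_mem`). Without the transposition all lengths are odd and `h`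
lies in the derived subgroup.

Conjugation by `g` copies `x` and `z` below `d'`, where they overlap with `y`. The overlaps are
arranged so that commutators of permutations with one common moved point yield three-cycles, and
conjugation then spreads these (`full_of_cycles`): `H` contains all three-cycles of cones of `A`. As
`z` mixes full-length words with the children of one word `a`, it also contains the three-cycles of
a child of `a` and two other words of `A`. The latter permit a descent on word length, giving the
three-cycles of all small cones outside `d` (`triIn_of_prefix_mem`). Finally `g` itself brings the
cone of `d` into reach (`derivedV_le_of_outside`).

For odd `n`, subdividing a word into its `n` children does not change the parity of the number of
inversions, so `V n` has a sign homomorphism, whose kernel is a proper nontrivial normal subgroup.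
-/

namespace HigmanThompson

open Equiv
open scoped commutatorElement

/-! ### Incomparable words, prefix replacement, and lifting permutations of antichains to the Cantor
space -/

section PrefixReplacement

variable {n : ℕ}

theorem perm_apply_inv_self {α : Type*} (σ : Perm α) (x : α) : σ (σ⁻¹ x) = x :=
  σ.apply_symm_apply x

theorem perm_inv_apply_self {α : Type*} (σ : Perm α) (x : α) : σ⁻¹ (σ x) = x :=
  σ.symm_apply_apply x

/-- Two words are incomparable for the prefix order. -/
def Perp (u v : Word n) : Prop := ¬ u <+: v ∧ ¬ v <+: u

/-- `h` replaces the prefix `u` by `v`. -/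
def Sends (h : Perm (Cantor n)) (u v : Word n) : Prop := ∀ w, h (app u w) = app v w

theorem app_injective (u : Word n) : Function.Injective (app u) := by
  intro w z h
  funext k
  have := congrFun h (k + u.length)
  simpa [app] using this

theorem mem_cone_app (u : Word n) (w : Cantor n) : app u w ∈ cone u := ⟨w, rfl⟩

theorem cone_anti {u v : Word n} (h : u <+: v) : cone v ⊆ cone u := by
  rintro x ⟨w, rfl⟩
  obtain ⟨t, rfl⟩ := h
  exact ⟨app t w, (app_append u t w).symm⟩

theorem prefix_or_prefix_of_app_eq {u v : Word n} {w z : Cantor n} (h : app u w = app v z) :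
    u <+: v ∨ v <+: u := by
  rcases le_total u.length v.length with hl | hl
  · obtain ⟨t, ht⟩ := prefix_of_app_eq hl h
    exact Or.inl ⟨t, ht.symm⟩
  · obtain ⟨t, ht⟩ := prefix_of_app_eq hl h.symm
    exact Or.inr ⟨t, ht.symm⟩

theorem Perp.symm {u v : Word n} (h : Perp u v) : Perp v u := ⟨h.2, h.1⟩

theorem Perp.app_ne {u v : Word n} (h : Perp u v) (w z : Cantor n) : app u w ≠ app v z := by
  intro he
  rcases prefix_or_prefix_of_app_eq he with h' | h'
  · exact h.1 h'
  · exact h.2 h'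

theorem Perp.notMem_cone {u v : Word n} (h : Perp u v) (w : Cantor n) : app u w ∉ cone v := by
  rintro ⟨z, hz⟩
  exact h.app_ne _ _ hz.symm

theorem Perp.ne {u v : Word n} (h : Perp u v) : u ≠ v := by
  rintro rfl
  exact h.1 (List.prefix_refl u)

theorem Perp.mono {u v u' v' : Word n} (h : Perp u v) (hu : u <+: u') (hv : v <+: v') :
    Perp u' v' := by
  constructor
  · intro h'
    rcases List.prefix_or_prefix_of_prefix (hu.trans h') hv with h1 | h1
    exacts [h.1 h1, h.2 h1]
  · intro h'
    rcases List.prefix_or_prefix_of_prefix hu (hv.trans h') with h1 | h1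
    exacts [h.1 h1, h.2 h1]

theorem perp_of_length_eq {u v : Word n} (hl : u.length = v.length) (h : u ≠ v) : Perp u v :=
  ⟨fun h' => h (h'.eq_of_length hl), fun h' => h (h'.eq_of_length hl.symm).symm⟩

theorem perp_append_left {d u v : Word n} : Perp (d ++ u) (d ++ v) ↔ Perp u v := by
  simp [Perp, List.prefix_append_right_inj]

theorem perp_of_forall_app_ne (w0 : Cantor n) {u v : Word n}
    (h : ∀ w z, app u w ≠ app v z) : Perp u v := by
  constructor
  · rintro ⟨t, rfl⟩
    exact h (app t w0) w0 (app_append u t w0).symm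
  · rintro ⟨t, rfl⟩
    exact h w0 (app t w0) (app_append v t w0)

theorem Sends.append {h : Perm (Cantor n)} {u v : Word n} (H : Sends h u v) (s : Word n) :
    Sends h (u ++ s) (v ++ s) := by
  intro w
  rw [app_append, app_append, H]

theorem Sends.mul {g h : Perm (Cantor n)} {u v w : Word n} (hg : Sends g v w) (hh : Sends h u v) :
    Sends (g * h) u w := fun z => by rw [Perm.mul_apply, hh, hg]

theorem Sends.inv {h : Perm (Cantor n)} {u v : Word n} (H : Sends h u v) : Sends h⁻¹ v u :=
  fun w => by rw [Perm.inv_eq_iff_eq, H]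

theorem sends_one (u : Word n) : Sends (1 : Perm (Cantor n)) u u := fun _ => rfl

theorem app_cons_zero (a : Fin n) (t : Word n) (w : Cantor n) : app (a :: t) w 0 = a := by
  simp [app]

theorem eq_of_app_eq (hn : 2 ≤ n) {u v : Word n} (h : ∀ w, app u w = app v w) : u = v := by
  have key : ∀ {u v : Word n}, (∀ w, app u w = app v w) → u.length ≤ v.length → u = v := by
    intro u v h hl
    have w0 : Cantor n := fun _ => ⟨0, by omega⟩
    obtain ⟨t, rfl⟩ := prefix_of_app_eq hl (h w0)
    rcases t with _ | ⟨a, t⟩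
    · simp
    · exfalso
      have : Nontrivial (Fin n) := Fin.nontrivial_iff_two_le.2 hn
      obtain ⟨b, hb⟩ := exists_ne a
      have h1 := h (fun _ => b)
      rw [app_append] at h1
      have h2 := congrFun (app_injective u h1) 0
      rw [app_cons_zero] at h2
      exact hb h2
  rcases le_total u.length v.length with hl | hl
  · exact key h hl
  · exact (key (fun w => (h w).symm) hl).symm

theorem Sends.unique (hn : 2 ≤ n) {h : Perm (Cantor n)} {u v v' : Word n} (H : Sends h u v)
    (H' : Sends h u v') : v = v' := eq_of_app_eq hn fun w => (H w).symm.trans (H' w)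

theorem Sends.perp (hn : 2 ≤ n) {h : Perm (Cantor n)} {u v u' v' : Word n} (H : Sends h u v)
    (H' : Sends h u' v') (hp : Perp u u') : Perp v v' := by
  refine perp_of_forall_app_ne (fun _ => ⟨0, by omega⟩) fun w z he => ?_
  rw [← H, ← H'] at he
  exact hp.app_ne _ _ (h.injective he)

/-- `h` replaces each prefix `e i` by `f i` and fixes all other points. -/
def Moves {ι : Type*} (e f : ι → Word n) (h : Perm (Cantor n)) : Prop :=
  (∀ i, Sends h (e i) (f i)) ∧ ∀ x, (∀ i, x ∉ cone (e i)) → h x = x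

/-- The subgroup `H` contains an element that moves `e` to `f`. -/
def Has {ι : Type*} (H : Subgroup (Perm (Cantor n))) (e f : ι → Word n) : Prop :=
  ∃ h ∈ H, Moves e f h

theorem Moves.conj {ι : Type*} {e f e' f' : ι → Word n} {h g : Perm (Cantor n)}
    (H : Moves e f h) (he : ∀ i, Sends g (e i) (e' i)) (hf : ∀ i, Sends g (f i) (f' i)) :
    Moves e' f' (g * h * g⁻¹) := by
  refine ⟨fun i => ((hf i).mul (H.1 i)).mul (he i).inv, fun x hx => ?_⟩
  have : h (g⁻¹ x) = g⁻¹ x := by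
    apply H.2
    rintro i ⟨w, hw⟩
    apply hx i
    refine ⟨w, ?_⟩
    rw [← he i, hw, perm_apply_inv_self]
  rw [Perm.mul_apply, Perm.mul_apply, this, perm_apply_inv_self]

theorem Moves.ext {ι : Type*} {e f : ι → Word n} {h g : Perm (Cantor n)}
    (H : Moves e f h) (H' : Moves e f g) : h = g := by
  ext1 x
  by_cases hx : ∀ i, x ∉ cone (e i)
  · rw [H.2 x hx, H'.2 x hx]
  · push Not at hx
    obtain ⟨i, w, rfl⟩ := hx
    rw [H.1, H'.1]

theorem Has.conj {ι : Type*} {H : Subgroup (Perm (Cantor n))} {e f e' f' : ι → Word n}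
    (hH : Has H e f) {g : Perm (Cantor n)} (hg : g ∈ H) (he : ∀ i, Sends g (e i) (e' i))
    (hf : ∀ i, Sends g (f i) (f' i)) : Has H e' f' := by
  obtain ⟨h, hh, hm⟩ := hH
  exact ⟨_, H.mul_mem (H.mul_mem hg hh) (H.inv_mem hg), hm.conj he hf⟩

theorem Has.mem {ι : Type*} {H : Subgroup (Perm (Cantor n))} {e f : ι → Word n}
    (hH : Has H e f) {g : Perm (Cantor n)} (hg : Moves e f g) : g ∈ H := by
  obtain ⟨h, hh, hm⟩ := hH
  rwa [← hm.ext hg]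

theorem perp_append_singleton {u : Word n} {i j : Fin n} (h : i ≠ j) :
    Perp (u ++ [i]) (u ++ [j]) :=
  perp_append_left.2 (perp_of_length_eq rfl (by simpa using h))

theorem app_succ (w : Cantor n) : app [w 0] (fun k => w (k + 1)) = w := by
  funext k
  rcases k with _ | k <;> simp [app]

/-- If a subgroup contains the prefix replacements on the `j`-th children for all `j`, then it
contains the prefix replacement on the parents. -/
theorem Has.of_children {ι : Type*} {H : Subgroup (Perm (Cantor n))} {e f : ι → Word n}
    (he : Pairwise fun i j => Perp (e i) (e j)) (hf : ∀ i, ∃ i', f i = e i')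
    (hH : ∀ j : Fin n, Has H (fun i => e i ++ [j]) (fun i => f i ++ [j])) : Has H e f := by
  -- The replacement on the parents is the product over the letters `j`. The factors do not
  -- interfere: each `f i` is some `e i'`, so the images under one letter avoid the cones moved
  -- under another.
  have key : ∀ T : Finset (Fin n), ∃ h ∈ H,
      (∀ j ∈ T, ∀ i, Sends h (e i ++ [j]) (f i ++ [j])) ∧
      ∀ x, (∀ j ∈ T, ∀ i, x ∉ cone (e i ++ [j])) → h x = x := by
    intro T
    induction T using Finset.induction_on with
    | empty => exact ⟨1, H.one_mem, by simp, fun _ _ => rfl⟩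
    | insert j₀ T hj ih =>
      obtain ⟨h, hh, h1, h2⟩ := ih
      obtain ⟨k, hk, k1, k2⟩ := hH j₀
      have hperp : ∀ j ∈ T, ∀ i i', Perp (e i ++ [j]) (e i' ++ [j₀]) := by
        intro j hjT i i'
        by_cases hi : i = i'
        · subst hi
          exact perp_append_singleton (by rintro rfl; exact hj hjT)
        · exact (he hi).mono (List.prefix_append _ _) (List.prefix_append _ _)
      refine ⟨k * h, H.mul_mem hk hh, ?_, ?_⟩
      · intro j hjT i
        rcases Finset.mem_insert.1 hjT with rfl | hjT
        · intro w
          rw [Perm.mul_apply, h2, k1]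
          intro j' hj' i'
          exact (hperp j' hj' i' i).symm.notMem_cone w
        · intro w
          rw [Perm.mul_apply, h1 j hjT, k2]
          intro i'
          obtain ⟨i'', hi''⟩ := hf i
          rw [hi'']
          exact (hperp j hjT i'' i').notMem_cone w
      · intro x hx
        rw [Perm.mul_apply, h2 x fun j hjT => hx j (Finset.mem_insert_of_mem hjT),
          k2 x (hx j₀ (Finset.mem_insert_self _ _))]
  obtain ⟨h, hh, h1, h2⟩ := key Finset.univ
  refine ⟨h, hh, fun i w => ?_, fun x hx => h2 x fun j _ i hc => hx i ?_⟩
  · rw [← app_succ w, ← app_append, ← app_append]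
    exact h1 _ (Finset.mem_univ _) i _
  · exact cone_anti (List.prefix_append _ _) hc

/-- This reduces questions to arbitrarily small cones, which is needed because an element of `V n`
replaces prefixes only on sufficiently long words. -/
theorem Has.of_descendants {ι : Type*} {H : Subgroup (Perm (Cantor n))} (k : ℕ)
    {e f : ι → Word n} (he : Pairwise fun i j => Perp (e i) (e j)) (hf : ∀ i, ∃ i', f i = e i')
    (hH : ∀ s : Word n, s.length = k → Has H (fun i => e i ++ s) (fun i => f i ++ s)) :
    Has H e f := by
  induction k generalizing e f with
  | zero => simpa using hH [] rfl
  | succ k ih =>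
    refine Has.of_children he hf fun j => ih ?_ ?_ ?_
    · intro i i' hi
      exact (he hi).mono (List.prefix_append _ _) (List.prefix_append _ _)
    · intro i
      obtain ⟨i', hi'⟩ := hf i
      exact ⟨i', by rw [hi']⟩
    · intro s hs
      simpa using hH (j :: s) (by simp [hs])

/-- `H` contains the three-cycle of the cones of `a`, `b` and `c`. -/
def TriIn (H : Subgroup (Perm (Cantor n))) (a b c : Word n) : Prop :=
  Has H ![a, b, c] ![b, c, a]

/-- `H` contains the transposition of the cones of `a` and `b`. -/
def SwapIn (H : Subgroup (Perm (Cantor n))) (a b : Word n) : Prop := Has H ![a, b] ![b, a]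

theorem moves_three {a b c a' b' c' : Word n} {h : Perm (Cantor n)} :
    Moves ![a, b, c] ![a', b', c'] h ↔ Sends h a a' ∧ Sends h b b' ∧ Sends h c c' ∧
      ∀ x, x ∉ cone a → x ∉ cone b → x ∉ cone c → h x = x := by
  simp [Moves, Fin.forall_fin_succ, and_assoc]

theorem moves_two {a b a' b' : Word n} {h : Perm (Cantor n)} :
    Moves ![a, b] ![a', b'] h ↔ Sends h a a' ∧ Sends h b b' ∧
      ∀ x, x ∉ cone a → x ∉ cone b → h x = x := by
  simp [Moves, Fin.forall_fin_succ, and_assoc]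

theorem TriIn.conj {H : Subgroup (Perm (Cantor n))} {a b c a' b' c' : Word n}
    (hH : TriIn H a b c) {g : Perm (Cantor n)} (hg : g ∈ H) (ha : Sends g a a')
    (hb : Sends g b b') (hc : Sends g c c') : TriIn H a' b' c' := by
  apply Has.conj hH hg
  · simp [Fin.forall_fin_succ, ha, hb, hc]
  · simp [Fin.forall_fin_succ, ha, hb, hc]

theorem TriIn.rotate {H : Subgroup (Perm (Cantor n))} {a b c : Word n} (hH : TriIn H a b c) :
    TriIn H b c a := by
  obtain ⟨h, hh, hm⟩ := hH
  rw [moves_three] at hm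
  exact ⟨h, hh, moves_three.2 ⟨hm.2.1, hm.2.2.1, hm.1, fun x h1 h2 h3 => hm.2.2.2 x h3 h1 h2⟩⟩

theorem TriIn.exists_sends {H : Subgroup (Perm (Cantor n))} {a b c : Word n}
    (hH : TriIn H a b c) : ∃ h ∈ H, Sends h a b ∧ Sends h b c ∧ Sends h c a ∧
      ∀ v, Perp v a → Perp v b → Perp v c → Sends h v v := by
  obtain ⟨h, hh, hm⟩ := hH
  rw [moves_three] at hm
  exact ⟨h, hh, hm.1, hm.2.1, hm.2.2.1, fun v h1 h2 h3 w =>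
    hm.2.2.2 _ (h1.notMem_cone w) (h2.notMem_cone w) (h3.notMem_cone w)⟩

theorem TriIn.mono {H K : Subgroup (Perm (Cantor n))} (hHK : H ≤ K) {a b c : Word n}
    (hH : TriIn H a b c) : TriIn K a b c := by
  obtain ⟨h, hh, hm⟩ := hH
  exact ⟨h, hHK hh, hm⟩

/-- `h` permutes the cones of the words in `S` as `σ` does, and fixes all other points. -/
def Lifts (S : Set (Word n)) (σ : Perm (Word n)) (h : Perm (Cantor n)) : Prop :=
  Moves (fun u : S => (u : Word n)) (fun u => σ u) h

theorem lifts_iff {S : Set (Word n)} {σ : Perm (Word n)} {h : Perm (Cantor n)} :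
    Lifts S σ h ↔ (∀ u ∈ S, Sends h u (σ u)) ∧ ∀ x, (∀ u ∈ S, x ∉ cone u) → h x = x := by
  simp [Lifts, Moves]

theorem mem_of_fixes {α : Type*} {S : Set α} {σ : Perm α} (hσ : ∀ u ∉ S, σ u = u) {u : α}
    (hu : u ∈ S) : σ u ∈ S := by
  by_contra h
  have := σ.injective (hσ _ h)
  rw [this] at h
  exact h hu

theorem inv_fixes {α : Type*} {S : Set α} {σ : Perm α} (hσ : ∀ u ∉ S, σ u = u) :
    ∀ u ∉ S, σ⁻¹ u = u := fun u hu => by rw [Perm.inv_eq_iff_eq, hσ u hu]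

theorem Lifts.inv {S : Set (Word n)} {σ : Perm (Word n)} {h : Perm (Cantor n)}
    (hσ : ∀ u ∉ S, σ u = u) (H : Lifts S σ h) : Lifts S σ⁻¹ h⁻¹ := by
  rw [lifts_iff] at *
  refine ⟨fun u hu => ?_, fun x hx => ?_⟩
  · have := H.1 (σ⁻¹ u) (mem_of_fixes (inv_fixes hσ) hu)
    rw [perm_apply_inv_self] at this
    exact this.inv
  · rw [Perm.inv_eq_iff_eq, H.2 x hx]

theorem Lifts.mul {S : Set (Word n)} {σ τ : Perm (Word n)} {h k : Perm (Cantor n)}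
    (hτ : ∀ u ∉ S, τ u = u) (H : Lifts S σ h) (K : Lifts S τ k) : Lifts S (σ * τ) (h * k) := by
  rw [lifts_iff] at *
  refine ⟨fun u hu => (H.1 _ (mem_of_fixes hτ hu)).mul (K.1 u hu), fun x hx => ?_⟩
  rw [Perm.mul_apply, K.2 x hx, H.2 x hx]

/-- The permutations of the words in `S` that lift to elements of `H`. -/
def wordPerms (S : Set (Word n)) (H : Subgroup (Perm (Cantor n))) : Subgroup (Perm (Word n)) where
  carrier := {σ | (∀ u ∉ S, σ u = u) ∧ ∃ h ∈ H, Lifts S σ h}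
  one_mem' := ⟨fun _ _ => rfl, 1, H.one_mem, fun u => sends_one _, fun _ _ => rfl⟩
  mul_mem' := by
    rintro σ τ ⟨hσ, h, hh, H1⟩ ⟨hτ, k, hk, H2⟩
    exact ⟨fun u hu => by rw [Perm.mul_apply, hτ u hu, hσ u hu], h * k, H.mul_mem hh hk,
      H1.mul hτ H2⟩
  inv_mem' := by
    rintro σ ⟨hσ, h, hh, H1⟩
    exact ⟨inv_fixes hσ, h⁻¹, H.inv_mem hh, H1.inv hσ⟩

theorem mem_wordPerms {S : Set (Word n)} {H : Subgroup (Perm (Cantor n))} {σ : Perm (Word n)} :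
    σ ∈ wordPerms S H ↔ (∀ u ∉ S, σ u = u) ∧ ∃ h ∈ H, Lifts S σ h := Iff.rfl

/-- The words of `S'` outside `S` are fixed by `σ`, so their cones are fixed either way. The ambient
antichain may thus be changed freely, and two antichains compared through their common words. -/
theorem lifts_subset_iff {S S' : Set (Word n)} (hS : S ⊆ S') (hS' : S'.Pairwise Perp)
    {σ : Perm (Word n)} (hσ : ∀ u ∉ S, σ u = u) {h : Perm (Cantor n)} :
    Lifts S σ h ↔ Lifts S' σ h := by
  rw [lifts_iff, lifts_iff]
  constructor
  · rintro ⟨h1, h2⟩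
    refine ⟨fun u hu => ?_, fun x hx => h2 x fun u hu => hx u (hS hu)⟩
    by_cases hu' : u ∈ S
    · exact h1 u hu'
    · intro w
      rw [hσ u hu', h2]
      intro v hv
      exact (hS' hu (hS hv) (by rintro rfl; exact hu' hv)).notMem_cone w
  · rintro ⟨h1, h2⟩
    refine ⟨fun u hu => h1 u (hS hu), fun x hx => ?_⟩
    by_cases hx' : ∀ u ∈ S', x ∉ cone u
    · exact h2 x hx'
    · push Not at hx'
      obtain ⟨u, hu, w, rfl⟩ := hx'
      rw [h1 u hu, hσ u fun hu' => hx u hu' (mem_cone_app u w)]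

theorem wordPerms_subset_iff {S S' : Set (Word n)} (hS : S ⊆ S') (hS' : S'.Pairwise Perp)
    {H : Subgroup (Perm (Cantor n))} {σ : Perm (Word n)} (hσ : ∀ u ∉ S, σ u = u) :
    σ ∈ wordPerms S H ↔ σ ∈ wordPerms S' H := by
  simp only [mem_wordPerms, lifts_subset_iff hS hS' hσ]
  exact and_congr_left fun _ => ⟨fun _ u hu => hσ u fun h => hu (hS h), fun _ => hσ⟩

theorem exists_lifts {S : Set (Word n)} (hS : S.Pairwise Perp) {σ : Perm (Word n)}
    (hσ : ∀ u ∉ S, σ u = u) : ∃ h, Lifts S σ h := by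
  classical
  -- The cones are disjoint, so the chosen prefix and tail of a point are the only ones.
  let F : Perm (Word n) → Cantor n → Cantor n := fun σ x =>
    if hx : ∃ u : Word n, u ∈ S ∧ ∃ w, app u w = x then
      app (σ hx.choose) hx.choose_spec.2.choose else x
  have F1 : ∀ (σ : Perm (Word n)) (u : Word n), u ∈ S → ∀ w, F σ (app u w) = app (σ u) w := by
    intro σ u hu w
    have hx : ∃ u' : Word n, u' ∈ S ∧ ∃ w', app u' w' = app u w := ⟨u, hu, w, rfl⟩
    have h1 : hx.choose = u := by
      by_contra hne
      exact (hS hx.choose_spec.1 hu hne).app_ne _ _ hx.choose_spec.2.choose_spec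
    have h2 : hx.choose_spec.2.choose = w := by
      have := hx.choose_spec.2.choose_spec
      exact app_injective u ((congrArg (fun v => app v _) h1).symm.trans this)
    simp only [F]
    rw [dif_pos hx, h2, h1]
  have F2 : ∀ (σ : Perm (Word n)) x, (∀ u ∈ S, x ∉ cone u) → F σ x = x := by
    intro σ x hx
    simp only [F]
    rw [dif_neg]
    rintro ⟨u, hu, hw⟩
    exact hx u hu hw
  have F3 : ∀ σ : Perm (Word n), (∀ u ∉ S, σ u = u) → ∀ x, F σ⁻¹ (F σ x) = x := by
    intro σ hσ x
    by_cases hx : ∀ u ∈ S, x ∉ cone u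
    · rw [F2 σ x hx, F2 _ x hx]
    · push Not at hx
      obtain ⟨u, hu, w, rfl⟩ := hx
      rw [F1 σ u hu, F1 _ _ (mem_of_fixes hσ hu), perm_inv_apply_self]
  refine ⟨⟨F σ, F σ⁻¹, F3 σ hσ, ?_⟩, lifts_iff.2 ⟨fun u hu w => F1 σ u hu w, F2 σ⟩⟩
  have := F3 σ⁻¹ (inv_fixes hσ)
  rwa [inv_inv] at this

theorem mem_V_iff {g : Perm (Cantor n)} :
    g ∈ V n ↔ ∃ N : ℕ, ∀ u : Word n, u.length = N → ∃ v, Sends g u v :=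
  exists_isBasisPair_iff g

theorem exists_sends_of_mem_V {g : Perm (Cantor n)} (hg : g ∈ V n) (L : ℕ) :
    ∃ N : ℕ, ∀ u : Word n, N ≤ u.length → ∃ v, Sends g u v ∧ L ≤ v.length := by
  obtain ⟨N, hN⟩ := mem_V_iff.1 hg
  refine ⟨N + L, fun u hu => ?_⟩
  obtain ⟨v, hv⟩ := hN (u.take N) (by simp; omega)
  refine ⟨v ++ u.drop N, ?_, by simp; omega⟩
  have := hv.append (u.drop N)
  rwa [List.take_append_drop] at this

theorem app_notMem_cone {S : Set (Word n)} {u : Word n} (hl : ∀ v ∈ S, v.length ≤ u.length)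
    (h : ∀ v ∈ S, ¬ v <+: u) (w : Cantor n) : ∀ v ∈ S, app u w ∉ cone v := by
  rintro v hv ⟨z, hz⟩
  obtain ⟨t, ht⟩ := prefix_of_app_eq (hl v hv) hz
  exact h v hv ⟨t, ht.symm⟩

theorem Lifts.mem_V {S : Set (Word n)} (hf : S.Finite) {σ : Perm (Word n)} {h : Perm (Cantor n)}
    (H : Lifts S σ h) : h ∈ V n := by
  rw [lifts_iff] at H
  refine mem_V_iff.2 ⟨hf.toFinset.sup List.length, fun u hu => ?_⟩
  by_cases hp : ∃ v ∈ S, v <+: u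
  · obtain ⟨v, hv, t, rfl⟩ := hp
    exact ⟨_, (H.1 v hv).append t⟩
  · push Not at hp
    refine ⟨u, fun w => H.2 _ (app_notMem_cone (fun v hv => ?_) hp w)⟩
    rw [hu]
    exact Finset.le_sup (f := List.length) (hf.mem_toFinset.2 hv)

/-- Every finite antichain of words is contained in a basis. -/
theorem exists_isBasis_superset {S : Set (Word n)} (hf : S.Finite) (hS : S.Pairwise Perp) :
    ∃ B : Finset (Word n), IsBasis B ∧ S ⊆ B ∧ (B : Set (Word n)).Pairwise Perp := by
  classical
  set N := hf.toFinset.sup List.length with hN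
  have hl : ∀ v ∈ S, v.length ≤ N := fun v hv =>
    Finset.le_sup (f := List.length) (hf.mem_toFinset.2 hv)
  -- `S` is completed by the words of the maximal length `N` that have no prefix in `S`.
  have hP : (↑(hf.toFinset ∪ (level n N).filter fun u => ∀ v ∈ S, ¬ v <+: u) :
      Set (Word n)).Pairwise Perp := by
    intro u hu v hv hne
    simp only [Finset.coe_union, Set.Finite.coe_toFinset, Finset.coe_filter, mem_level,
      Set.mem_union, Set.mem_ofPred_eq] at hu hv
    rcases hu with hu | hu <;> rcases hv with hv | hv
    · exact hS hu hv hne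
    · refine ⟨hv.2 u hu, fun h => hne ?_⟩
      exact (h.eq_of_length (le_antisymm h.length_le (hv.1 ▸ hl u hu))).symm
    · refine ⟨fun h => hne ?_, hu.2 v hv⟩
      exact (h.eq_of_length (le_antisymm h.length_le (hu.1 ▸ hl v hv)))
    · exact perp_of_length_eq (hu.1.trans hv.1.symm) hne
  refine ⟨_, fun x => ?_, fun u hu => by simp [hu], hP⟩
  have hex : ∃ u ∈ hf.toFinset ∪ (level n N).filter fun u => ∀ v ∈ S, ¬ v <+: u, x ∈ cone u := by
    obtain ⟨u, ⟨hu, w, rfl⟩, -⟩ := isBasis_level n N x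
    by_cases hp : ∃ v ∈ S, v <+: u
    · obtain ⟨v, hv, hvu⟩ := hp
      exact ⟨v, by simp [hv], cone_anti hvu (mem_cone_app u w)⟩
    · push Not at hp
      exact ⟨u, by simp [hu]; exact Or.inr hp, mem_cone_app u w⟩
  obtain ⟨u, hu, hxu⟩ := hex
  refine ⟨u, ⟨hu, hxu⟩, ?_⟩
  rintro v ⟨hv, z, hz⟩
  by_contra hne
  exact (hP hv hu hne).notMem_cone z (hz ▸ hxu)

theorem IsBasis.pairwise_perp (w0 : Cantor n) {A : Finset (Word n)} (hA : IsBasis A) :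
    (A : Set (Word n)).Pairwise Perp := by
  intro u hu v hv hne
  refine perp_of_forall_app_ne w0 fun w z h => hne ?_
  exact (hA (app u w)).unique ⟨hu, mem_cone_app u w⟩ ⟨hv, h ▸ mem_cone_app v z⟩

end PrefixReplacement

/-! ### Three-cycles in permutation groups, and splitting products of coprime orders -/

section ThreeCycles

variable {α : Type*} [DecidableEq α]

/-- The three-cycle `a ↦ b ↦ c ↦ a`, when `a`, `b`, `c` are distinct. -/
def tri (a b c : α) : Perm α := swap a b * swap b c

/-- `K` contains all three-cycles of points of `T`. -/
def Full (K : Subgroup (Perm α)) (T : Set α) : Prop :=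
  ∀ a ∈ T, ∀ b ∈ T, ∀ c ∈ T, a ≠ b → b ≠ c → a ≠ c → tri a b c ∈ K

theorem tri_conj (σ : Perm α) (a b c : α) : σ * tri a b c * σ⁻¹ = tri (σ a) (σ b) (σ c) := by
  rw [tri, tri, swap_apply_apply, swap_apply_apply]
  group

theorem tri_apply_left {a b c : α} (h : a ≠ b) (h' : a ≠ c) : tri a b c a = b := by
  rw [tri, Perm.mul_apply, swap_apply_of_ne_of_ne h h', swap_apply_left]

theorem tri_apply_mid {a b c : α} (h : b ≠ c) (h' : a ≠ c) : tri a b c b = c := by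
  rw [tri, Perm.mul_apply, swap_apply_left, swap_apply_of_ne_of_ne h'.symm h.symm]

theorem tri_apply_right (a b c : α) : tri a b c c = a := by
  rw [tri, Perm.mul_apply, swap_apply_right, swap_apply_right]

theorem tri_apply_of_ne {a b c x : α} (ha : x ≠ a) (hb : x ≠ b) (hc : x ≠ c) :
    tri a b c x = x := by
  rw [tri, Perm.mul_apply, swap_apply_of_ne_of_ne hb hc, swap_apply_of_ne_of_ne ha hb]

theorem eq_tri {a b c : α} (hab : a ≠ b) (hbc : b ≠ c) (hac : a ≠ c) {σ : Perm α} (h1 : σ a = b)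
    (h2 : σ b = c) (h3 : σ c = a) (h4 : ∀ x, x ≠ a → x ≠ b → x ≠ c → σ x = x) :
    σ = tri a b c := by
  ext x
  by_cases ha : x = a
  · rw [ha, h1, tri_apply_left hab hac]
  by_cases hb : x = b
  · rw [hb, h2, tri_apply_mid hbc hac]
  by_cases hc : x = c
  · rw [hc, h3, tri_apply_right]
  rw [h4 x ha hb hc, tri_apply_of_ne ha hb hc]

theorem tri_rotate {a b c : α} (hab : a ≠ b) (hbc : b ≠ c) (hac : a ≠ c) :
    tri a b c = tri b c a :=
  eq_tri hbc hac.symm hab.symm (tri_apply_mid hbc hac) (tri_apply_right _ _ _)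
    (tri_apply_left hab hac) fun _ h1 h2 h3 => tri_apply_of_ne h3 h1 h2

theorem tri_inv (a b c : α) : (tri a b c)⁻¹ = tri c b a := by
  rw [tri, tri, mul_inv_rev, swap_inv, swap_inv, swap_comm b c, swap_comm a b]

theorem tri_swap_mem {K : Subgroup (Perm α)} {a b c : α} (hab : a ≠ b) (hbc : b ≠ c) (hac : a ≠ c)
    (h : tri a b c ∈ K) : tri b a c ∈ K := by
  have := K.inv_mem h
  rwa [tri_inv, tri_rotate hbc.symm hab.symm hac.symm] at this

theorem Full.subset {K : Subgroup (Perm α)} {T T' : Set α} (h : Full K T) (hT : T' ⊆ T) :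
    Full K T' := fun a ha b hb c hc => h a (hT ha) b (hT hb) c (hT hc)

/-- Conjugating `(s t w)` by three-cycles of `T` replaces `s` and `t` by any two points of `T`. -/
theorem Full.insert_of_mem {K : Subgroup (Perm α)} {T : Set α} (hT : Full K T) {s t w : α} (hs : s ∈ T)
    (ht : t ∈ T) (hst : s ≠ t) (hw : tri s t w ∈ K) : Full K (insert w T) := by
  by_cases hwT : w ∈ T
  · rwa [Set.insert_eq_of_mem hwT]
  have hne : ∀ x ∈ T, x ≠ w := by
    rintro x hx rfl
    exact hwT hx
  have rev : ∀ x ∈ T, ∀ y ∈ T, x ≠ y → tri x y w ∈ K → tri y x w ∈ K := fun x hx y hy hxy h =>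
    tri_swap_mem hxy (hne y hy) (hne x hx) h
  -- The three-cycle `x ↦ z ↦ y ↦ x` conjugates `(x y w)` to `(z x w)`.
  have step : ∀ x ∈ T, ∀ y ∈ T, ∀ z ∈ T, x ≠ y → z ≠ x → z ≠ y → tri x y w ∈ K →
      tri z x w ∈ K := by
    intro x hx y hy z hz hxy hzx hzy h
    have h1 := hT x hx z hz y hy hzx.symm hzy hxy
    have h2 := K.mul_mem (K.mul_mem h1 h) (K.inv_mem h1)
    rwa [tri_conj, tri_apply_left hzx.symm hxy, tri_apply_right,
      tri_apply_of_ne (hne x hx).symm (hne z hz).symm (hne y hy).symm] at h2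
  have h1 : ∀ x ∈ T, x ≠ s → tri x s w ∈ K := by
    intro x hx hxs
    by_cases hxt : x = t
    · rw [hxt]
      exact rev s hs t ht hst hw
    · exact step s hs t ht x hx hst hxs hxt hw
  have h2 : ∀ x ∈ T, ∀ y ∈ T, x ≠ y → tri x y w ∈ K := by
    intro x hx y hy hxy
    by_cases hys : y = s
    · subst hys
      exact h1 x hx hxy
    by_cases hxs : x = s
    · subst hxs
      exact rev y hy x hx hys (h1 y hy hys)
    · exact step y hy s hs x hx hys hxy hxs (h1 y hy hys)
  intro a ha b hb c hc hab hbc hac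
  rcases ha with rfl | ha
  · have hb' := hb.resolve_left hab.symm
    have hc' := hc.resolve_left hac.symm
    rw [tri_rotate hab hbc hac]
    exact h2 b hb' c hc' hbc
  rcases hb with rfl | hb
  · have hc' := hc.resolve_left hbc.symm
    rw [tri_rotate hab hbc hac, tri_rotate hbc hac.symm hab.symm]
    exact h2 c hc' a ha hac.symm
  rcases hc with rfl | hc
  · exact h2 a ha b hb hab
  · exact hT a ha b hb c hc hab hbc hac

/-- The two common points provide the three-cycle `(s t w)` for each new point `w` of `T'`, so
points can be added one by one. -/
theorem Full.union {K : Subgroup (Perm α)} {T T' : Set α} (hT : Full K T) (hT' : Full K T')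
    {s t : α} (hs : s ∈ T) (hs' : s ∈ T') (ht : t ∈ T) (ht' : t ∈ T') (hst : s ≠ t) :
    Full K (T ∪ T') := by
  have step : ∀ R : Set α, Full K R → s ∈ R → t ∈ R → ∀ w ∈ T ∪ T', w ∈ T ∨
      Full K (insert w R) := by
    intro R hR hsR htR w hw
    rcases hw with hw | hw
    · exact Or.inl hw
    · right
      by_cases hwR : w ∈ R
      · rwa [Set.insert_eq_of_mem hwR]
      · refine hR.insert_of_mem hsR htR hst (hT' s hs' t ht' w hw hst ?_ ?_)
        · rintro rfl; exact hwR htR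
        · rintro rfl; exact hwR hsR
  have add : ∀ R : Set α, T ⊆ R → Full K R → ∀ w ∈ T ∪ T', Full K (insert w R) := by
    intro R hTR hR w hw
    rcases step R hR (hTR hs) (hTR ht) w hw with h | h
    · rwa [Set.insert_eq_of_mem (hTR h)]
    · exact h
  intro a ha b hb c hc
  have h1 := add T subset_rfl hT a ha
  have h2 := add _ (Set.subset_insert _ _) h1 b hb
  have h3 := add _ ((Set.subset_insert _ _).trans (Set.subset_insert _ _)) h2 c hc
  exact h3 a (by simp) b (by simp) c (by simp)

/-- Conjugating the three-cycle on `b`, `z b`, `c` by `z ^ j` leaves `c` in place and links `(z ^ j)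
b` to `(z ^ (j + 1)) b`. Thus the orbit is added one point at a time. -/
theorem Full.orbit {K : Subgroup (Perm α)} {T : Set α} (hT : Full K T) {z : Perm α} (hz : z ∈ K)
    {b c : α} (hb : b ∈ T) (hzb : z b ∈ T) (hne : z b ≠ b) (hc : c ∈ T) (hzc : z c = c) :
    Full K (T ∪ {u | ∃ j : ℕ, (z ^ j) b = u}) := by
  have hbc : b ≠ c := by
    rintro rfl
    exact hne hzc
  have hzbc : z b ≠ c := fun h => hbc (z.injective (h.trans hzc.symm))
  have hpow : ∀ j : ℕ, (z ^ j) c = c := fun j => Perm.pow_apply_eq_self_of_apply_eq_self hzc j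
  have key : ∀ J : ℕ, Full K (T ∪ {u | ∃ j ≤ J, (z ^ j) b = u}) := by
    intro J
    induction J with
    | zero =>
      refine hT.subset ?_
      rintro u (hu | ⟨j, hj, rfl⟩)
      · exact hu
      · obtain rfl : j = 0 := by omega
        exact hb
    | succ J ih =>
      have h1 : tri ((z ^ J) b) ((z ^ J) (z b)) c ∈ K := by
        have := K.mul_mem (K.mul_mem (K.pow_mem hz J) (hT b hb (z b) hzb c hc hne.symm hzbc hbc))
          (K.inv_mem (K.pow_mem hz J))
        rwa [tri_conj, hpow] at this
      have e1 : (z ^ J) b ≠ (z ^ J) (z b) := fun h => hne ((z ^ J).injective h).symm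
      have e2 : (z ^ J) b ≠ c := fun h => hbc ((z ^ J).injective (h.trans (hpow J).symm))
      have e3 : (z ^ J) (z b) ≠ c := fun h => hzbc ((z ^ J).injective (h.trans (hpow J).symm))
      have h2 : tri c ((z ^ J) b) ((z ^ J) (z b)) ∈ K := by
        rwa [tri_rotate e2.symm e1 e3.symm]
      refine (ih.insert_of_mem (Or.inl hc) (Or.inr ⟨J, le_rfl, rfl⟩) e2.symm h2).subset ?_
      rintro u (hu | ⟨j, hj, rfl⟩)
      · exact Or.inr (Or.inl hu)
      · rcases Nat.lt_or_ge J j with hJ | hJ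
        · obtain rfl : j = J + 1 := by omega
          left
          rw [pow_succ, Perm.mul_apply]
        · exact Or.inr (Or.inr ⟨j, hJ, rfl⟩)
  rintro a ha b' hb' c' hc'
  have hmem : ∀ u ∈ T ∪ {u | ∃ j : ℕ, (z ^ j) b = u}, ∃ J : ℕ, ∀ J' ≥ J,
      u ∈ T ∪ {u | ∃ j ≤ J', (z ^ j) b = u} := by
    rintro u (hu | ⟨j, hj⟩)
    · exact ⟨0, fun _ _ => Or.inl hu⟩
    · exact ⟨j, fun J' hJ' => Or.inr ⟨j, hJ', hj⟩⟩
  obtain ⟨J1, h1⟩ := hmem a ha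
  obtain ⟨J2, h2⟩ := hmem b' hb'
  obtain ⟨J3, h3⟩ := hmem c' hc'
  exact key (J1 + J2 + J3) a (h1 _ (by omega)) b' (h2 _ (by omega)) c' (h3 _ (by omega))

/-- The commutator of two permutations with a single common moved point is a three-cycle. -/
theorem commutator_eq_tri {z τ : Perm α} {b : α} (h : ∀ u, z u ≠ u → τ u ≠ u → u = b)
    (hz : z b ≠ b) (hτ : τ b ≠ b) : z * τ * z⁻¹ * τ⁻¹ = tri b (z b) (τ b) := by
  have hzz : z (z b) ≠ z b := fun h' => hz (z.injective h')
  have hττ : τ (τ b) ≠ τ b := fun h' => hτ (τ.injective h')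
  have h1 : τ (z b) = z b := by
    by_contra h'
    exact hz (h _ hzz h')
  have h2 : z (τ b) = τ b := by
    by_contra h'
    exact hτ (h _ h' hττ)
  have h3 : τ (z⁻¹ b) = z⁻¹ b := by
    by_contra h'
    have h4 : z (z⁻¹ b) ≠ z⁻¹ b := by
      rw [perm_apply_inv_self]
      intro h5
      exact hz (Perm.eq_inv_iff_eq.1 h5)
    have h5 := h _ h4 h'
    rw [Perm.inv_eq_iff_eq] at h5
    exact hz h5.symm
  have h4 : z (τ⁻¹ b) = τ⁻¹ b := by
    by_contra h'
    have h4 : τ (τ⁻¹ b) ≠ τ⁻¹ b := by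
      rw [perm_apply_inv_self]
      intro h5
      exact hτ (Perm.eq_inv_iff_eq.1 h5)
    have h5 := h _ h' h4
    rw [Perm.inv_eq_iff_eq] at h5
    exact hτ h5.symm
  have hne : z b ≠ τ b := fun h' => by rw [h'] at h1; exact hττ h1
  refine eq_tri hz.symm hne hτ.symm ?_ ?_ ?_ ?_
  · simp only [Perm.mul_apply]
    rw [(Perm.inv_eq_iff_eq (f := z)).2 h4.symm, perm_apply_inv_self]
  · simp only [Perm.mul_apply]
    rw [(Perm.inv_eq_iff_eq (f := τ)).2 h1.symm, perm_inv_apply_self, h2]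
  · simp only [Perm.mul_apply]
    rw [perm_inv_apply_self, h3, perm_apply_inv_self]
  · intro x hxb hxz hxτ
    simp only [Perm.mul_apply]
    by_cases hx : τ x = x
    · rw [(Perm.inv_eq_iff_eq (f := τ)).2 hx.symm]
      have : τ (z⁻¹ x) = z⁻¹ x := by
        by_contra h'
        by_cases hzx : z x = x
        · rw [(Perm.inv_eq_iff_eq (f := z)).2 hzx.symm] at h'
          exact h' hx
        · have h5 := h _ (by
            rw [perm_apply_inv_self]
            intro h6
            exact hzx (Perm.eq_inv_iff_eq.1 h6)) h'
          rw [Perm.inv_eq_iff_eq] at h5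
          exact hxz h5
      rw [this, perm_apply_inv_self]
    · have h5 : τ (τ⁻¹ x) ≠ τ⁻¹ x := by
        rw [perm_apply_inv_self]
        intro h5
        exact hx (Perm.eq_inv_iff_eq.1 h5)
      have h6 : z (τ⁻¹ x) = τ⁻¹ x := by
        by_contra h'
        have := h _ h' h5
        rw [Perm.inv_eq_iff_eq] at this
        exact hxτ this
      rw [(Perm.inv_eq_iff_eq (f := z)).2 h6.symm, perm_apply_inv_self]
      by_contra h'
      exact hxb (h _ h' hx)

theorem formPerm_map_apply {β : Type*} [DecidableEq β] {f : α → β} (hf : Function.Injective f)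
    (L : List α) (u : α) : (L.map f).formPerm (f u) = f (L.formPerm u) := by
  match L with
  | [] => simp
  | [a] => simp
  | a :: b :: L =>
    have ih := formPerm_map_apply hf (b :: L) u
    rw [List.map_cons] at ih
    simp only [List.map_cons, List.formPerm_cons_cons, Perm.mul_apply]
    rw [ih, hf.map_swap]

theorem formPerm_fixes {L : List α} : ∀ u ∉ {u | u ∈ L}, L.formPerm u = u :=
  fun _ hu => List.formPerm_apply_of_notMem hu

theorem formPerm_ne_self {L : List α} (hL : L.Nodup) (h2 : 2 ≤ L.length) {u : α} (hu : u ∈ L) :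
    L.formPerm u ≠ u := by
  rw [Ne, List.formPerm_apply_mem_eq_self_iff _ hL u hu]
  omega

theorem exists_formPerm_pow_eq {L : List α} (hL : L.Nodup) {u v : α} (hu : u ∈ L) (hv : v ∈ L) :
    ∃ j : ℕ, (L.formPerm ^ j) u = v := by
  obtain ⟨i, hi, rfl⟩ := List.getElem_of_mem hu
  obtain ⟨k, hk, rfl⟩ := List.getElem_of_mem hv
  refine ⟨L.length - i + k, ?_⟩
  rw [List.formPerm_pow_apply_getElem L hL]
  congr 1
  rw [show i + (L.length - i + k) = L.length + k by omega, Nat.add_mod_left, Nat.mod_eq_of_lt hk]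

/-- Two letters are peeled off at a time: `(a b c …) = (a b c)(c …)`. -/
theorem formPerm_mem_of_odd {K : Subgroup (Perm α)} {L : List α} (hL : L.Nodup)
    (ho : Odd L.length) (hK : Full K {u | u ∈ L}) : L.formPerm ∈ K := by
  match L with
  | [] => simp at ho
  | [a] => simp
  | [a, b] => simp at ho; exact absurd ho (by decide)
  | a :: b :: c :: L =>
    have ih := formPerm_mem_of_odd (K := K) (L := c :: L) (hL.of_cons.of_cons)
      (by
        simp only [List.length_cons] at ho ⊢
        rw [Nat.odd_iff] at *
        omega)
      (hK.subset fun u hu => List.mem_cons_of_mem _ (List.mem_cons_of_mem _ hu))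
    rw [List.formPerm_cons_cons, List.formPerm_cons_cons, ← mul_assoc]
    simp only [List.nodup_cons, List.mem_cons, not_or] at hL
    exact K.mul_mem (hK a (by simp) b (by simp) c (by simp) hL.1.1 hL.2.1.1 hL.1.2.1) ih

/-- `(a * b) ^ N = a ^ N`, and `a` is a power of `a ^ N` because `N` is prime to its order. -/
theorem mem_of_mul_mem_of_coprime {G : Type*} [Group G] {K : Subgroup G} {a b : G}
    (hab : Commute a b) {N : ℕ} (hN : b ^ N = 1) (hc : N.Coprime (orderOf a)) (h : a * b ∈ K) :
    a ∈ K ∧ b ∈ K := by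
  have ha : a ∈ K := by
    obtain ⟨m, hm⟩ := exists_pow_eq_self_of_coprime hc
    rw [← hm]
    have := K.pow_mem h N
    rw [hab.mul_pow, hN, mul_one] at this
    exact K.pow_mem this m
  exact ⟨ha, by simpa using K.mul_mem (K.inv_mem ha) h⟩

theorem list_prod_pow_eq_one {G : Type*} [Group G] {l : List G} (hl : l.Pairwise Commute) :
    l.prod ^ (l.map orderOf).prod = 1 := by
  induction l with
  | nil => simp
  | cons a l ih =>
    rw [List.pairwise_cons] at hl
    have hc : Commute a l.prod := Commute.list_prod_right _ _ hl.1
    rw [List.map_cons, List.prod_cons, List.prod_cons, hc.mul_pow, pow_mul, pow_orderOf_eq_one,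
      one_pow, mul_comm, pow_mul, ih hl.2, one_pow, one_mul]

/-- This recovers the single cycles from one element `h`, and is the reason for requiring coprime
orders. -/
theorem mem_of_list_prod_mem {G : Type*} [Group G] {K : Subgroup G} {l : List G}
    (hl : l.Pairwise Commute) (ho : l.Pairwise fun a b => (orderOf a).Coprime (orderOf b))
    (h : l.prod ∈ K) : ∀ a ∈ l, a ∈ K := by
  induction l with
  | nil => simp
  | cons a l ih =>
    rw [List.pairwise_cons] at hl ho
    have hc : Commute a l.prod := Commute.list_prod_right _ _ hl.1
    rw [List.prod_cons] at h
    obtain ⟨h1, h2⟩ := mem_of_mul_mem_of_coprime hc (list_prod_pow_eq_one hl.2)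
      (Nat.Coprime.symm (Nat.coprime_list_prod_right_iff.2 fun k hk => by
        obtain ⟨b, hb, rfl⟩ := List.mem_map.1 hk
        exact ho.1 b hb)) h
    intro b hb
    rcases List.mem_cons.1 hb with rfl | hb
    exacts [h1, ih hl.2 ho.2 h2 b hb]

end ThreeCycles

/-! ### Transpositions of cones generate the Higman–Thompson group -/

section Transpositions

variable {n : ℕ}

theorem sends_of_children {h : Perm (Cantor n)} {u v : Word n}
    (H : ∀ j, Sends h (u ++ [j]) (v ++ [j])) : Sends h u v := by
  intro w
  rw [← app_succ w, ← app_append, ← app_append]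
  exact H _ _

theorem Lifts.ext {S : Set (Word n)} {σ : Perm (Word n)} {h k : Perm (Cantor n)}
    (hh : Lifts S σ h) (hk : Lifts S σ k) : h = k := Moves.ext hh hk

theorem mem_of_lifts {S : Set (Word n)} {H : Subgroup (Perm (Cantor n))} {σ : Perm (Word n)}
    (hσ : σ ∈ wordPerms S H) {h : Perm (Cantor n)} (hh : Lifts S σ h) : h ∈ H := by
  obtain ⟨-, k, hk, hl⟩ := hσ
  rwa [hh.ext hl]

theorem lifts_swap_iff {S : Set (Word n)} (hS : S.Pairwise Perp) {a b : Word n} (ha : a ∈ S)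
    (hb : b ∈ S) {h : Perm (Cantor n)} :
    Lifts S (swap a b) h ↔ Moves ![a, b] ![b, a] h := by
  have hsub : ({a, b} : Set (Word n)) ⊆ S := by
    rintro u (rfl | rfl) <;> assumption
  rw [← lifts_subset_iff hsub hS, lifts_iff, moves_two]
  · simp only [Set.mem_insert_iff, Set.mem_singleton_iff, forall_eq_or_imp, forall_eq,
      swap_apply_left, swap_apply_right, and_assoc, and_imp]
  · intro u hu
    simp only [Set.mem_insert_iff, Set.mem_singleton_iff, not_or] at hu
    exact swap_apply_of_ne_of_ne hu.1 hu.2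

theorem swap_fixes {S : Set (Word n)} {a b : Word n} (ha : a ∈ S) (hb : b ∈ S) :
    ∀ u ∉ S, swap a b u = u := fun u hu =>
  swap_apply_of_ne_of_ne (by rintro rfl; exact hu ha) (by rintro rfl; exact hu hb)

theorem swap_mem_wordPerms {S : Set (Word n)} (hS : S.Pairwise Perp) {a b : Word n} (ha : a ∈ S)
    (hb : b ∈ S) {H : Subgroup (Perm (Cantor n))} :
    swap a b ∈ wordPerms S H ↔ SwapIn H a b := by
  rw [mem_wordPerms, and_iff_right (swap_fixes ha hb)]
  simp only [lifts_swap_iff hS ha hb, SwapIn, Has]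

theorem tri_fixes {S : Set (Word n)} {a b c : Word n} (ha : a ∈ S) (hb : b ∈ S) (hc : c ∈ S) :
    ∀ u ∉ S, tri a b c u = u := fun u hu =>
  tri_apply_of_ne (by rintro rfl; exact hu ha) (by rintro rfl; exact hu hb)
    (by rintro rfl; exact hu hc)

theorem lifts_tri_iff {S : Set (Word n)} (hS : S.Pairwise Perp) {a b c : Word n} (ha : a ∈ S)
    (hb : b ∈ S) (hc : c ∈ S) (hab : a ≠ b) (hbc : b ≠ c) (hac : a ≠ c) {h : Perm (Cantor n)} :
    Lifts S (tri a b c) h ↔ Moves ![a, b, c] ![b, c, a] h := by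
  have hsub : ({a, b, c} : Set (Word n)) ⊆ S := by
    rintro u (rfl | rfl | rfl) <;> assumption
  rw [← lifts_subset_iff hsub hS, lifts_iff, moves_three]
  · simp only [Set.mem_insert_iff, Set.mem_singleton_iff, forall_eq_or_imp, forall_eq,
      tri_apply_left hab hac, tri_apply_mid hbc hac, tri_apply_right, and_assoc, and_imp]
  · exact tri_fixes (by simp) (by simp) (by simp)

theorem tri_mem_wordPerms {S : Set (Word n)} (hS : S.Pairwise Perp) {a b c : Word n} (ha : a ∈ S)
    (hb : b ∈ S) (hc : c ∈ S) (hab : a ≠ b) (hbc : b ≠ c) (hac : a ≠ c)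
    {H : Subgroup (Perm (Cantor n))} :
    tri a b c ∈ wordPerms S H ↔ TriIn H a b c := by
  rw [mem_wordPerms, and_iff_right (tri_fixes ha hb hc)]
  simp only [lifts_tri_iff hS ha hb hc hab hbc hac, TriIn, Has]

theorem isBasis_of_pairwise {A : Finset (Word n)} (hP : (A : Set (Word n)).Pairwise Perp)
    (hA : ∀ x, ∃ u ∈ A, x ∈ cone u) : IsBasis A := by
  intro x
  obtain ⟨u, hu, hxu⟩ := hA x
  refine ⟨u, ⟨hu, hxu⟩, ?_⟩
  rintro v ⟨hv, z, hz⟩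
  by_contra hne
  exact (hP hv hu hne).notMem_cone z (hz ▸ hxu)

/-- The siblings of a longest word `u ++ [i]` all belong to `A`: a word of `A` whose cone meets that
of a sibling is not longer, and if shorter it would be a prefix of `u`, hence of the longest word.
-/
theorem exists_children_mem (w0 : Cantor n) {A : Finset (Word n)} (hA : IsBasis A)
    (hne : A ≠ {[]}) : ∃ u : Word n, ∀ j, u ++ [j] ∈ A := by
  have hP := hA.pairwise_perp w0
  obtain ⟨a₀, ⟨ha₀, -⟩, -⟩ := hA w0
  obtain ⟨a, ha, hmax⟩ := A.exists_max_image List.length ⟨a₀, ha₀⟩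
  rcases List.eq_nil_or_concat a with rfl | ⟨u, i, rfl⟩
  · exfalso
    apply hne
    ext b
    rw [Finset.mem_singleton]
    refine ⟨fun hb => ?_, fun hb => hb ▸ ha⟩
    exact List.length_eq_zero_iff.1 (by simpa using hmax b hb)
  · refine ⟨u, fun j => ?_⟩
    obtain ⟨b, ⟨hb, z, hz⟩, -⟩ := hA (app (u ++ [j]) w0)
    have hl := hmax b hb
    obtain ⟨t, ht⟩ := prefix_of_app_eq (u := u ++ [j]) (by simpa using hl) hz
    rcases List.eq_nil_or_concat t with rfl | ⟨t, k, rfl⟩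
    · rw [List.append_nil] at ht
      rwa [ht]
    · exfalso
      rw [List.concat_eq_append, ← List.append_assoc] at ht
      have h1 : u = b ++ t := (List.append_inj' ht rfl).1
      have h2 : b <+: u ++ [i] := by
        rw [h1, List.append_assoc]
        exact List.prefix_append _ _
      rw [List.concat_eq_append] at ha
      have hne' : b ≠ u ++ [i] := by
        intro h
        have := congrArg List.length h
        rw [h1] at this
        simp at this
      exact (hP hb ha hne').1 h2

/-- Replacing the children of `u` in a basis by `u` gives a basis. -/
theorem IsBasis.contract (w0 : Cantor n) {A : Finset (Word n)} (hA : IsBasis A) {u : Word n}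
    (hu : ∀ j, u ++ [j] ∈ A) : IsBasis (insert u (A.filter fun a => ¬ u <+: a)) := by
  have hP := hA.pairwise_perp w0
  have hua : ∀ a ∈ A, ¬ u <+: a → Perp u a := by
    refine fun a ha hau => ⟨hau, fun h => ?_⟩
    have h1 : a ≠ u ++ [w0 0] := by
      rintro rfl
      exact hau (List.prefix_append _ _)
    exact (hP ha (hu _) h1).1 (h.trans (List.prefix_append _ _))
  apply isBasis_of_pairwise
  · intro a ha b hb hab
    simp only [Finset.coe_insert, Finset.coe_filter, Set.mem_insert_iff, Set.mem_ofPred_eq]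
      at ha hb
    rcases ha with rfl | ha <;> rcases hb with rfl | hb
    · exact absurd rfl hab
    · exact hua b hb.1 hb.2
    · exact (hua a ha.1 ha.2).symm
    · exact hP ha.1 hb.1 hab
  · intro x
    obtain ⟨a, ⟨ha, hx⟩, -⟩ := hA x
    by_cases hau : u <+: a
    · exact ⟨u, Finset.mem_insert_self _ _, cone_anti hau hx⟩
    · exact ⟨a, by simp [ha, hau], hx⟩

theorem card_contract_lt (hn : 2 ≤ n) {A : Finset (Word n)} {u : Word n} (hu : ∀ j, u ++ [j] ∈ A) :
    (insert u (A.filter fun a => ¬ u <+: a)).card < A.card := by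
  have h1 : (A.filter fun a => u <+: a).card + (A.filter fun a => ¬ u <+: a).card = A.card := by
    convert Finset.card_filter_add_card_filter_not (s := A) fun a => u <+: a
  have h2 : 2 ≤ (A.filter fun a => u <+: a).card := by
    apply Finset.one_lt_card.2
    refine ⟨u ++ [(⟨0, by omega⟩ : Fin n)], by simp [hu], u ++ [(⟨1, by omega⟩ : Fin n)],
      by simp [hu], by simp⟩
  refine lt_of_le_of_lt (Finset.card_insert_le _ _) ?_
  omega

/-- One transposition puts each further word in place, and injectivity of `p` and `q` keeps the
earlier ones undisturbed. It serves to turn the images of one family of siblings into another such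
family. -/
theorem exists_mem_wordPerms_apply_eq {S : Set (Word n)} (hS : S.Pairwise Perp)
    {H : Subgroup (Perm (Cantor n))} (hH : ∀ a b : Word n, Perp a b → SwapIn H a b)
    {κ : Type*} [DecidableEq κ] {p q : κ → Word n} (hp : ∀ j, p j ∈ S) (hq : ∀ j, q j ∈ S)
    (hpi : Function.Injective p) (hqi : Function.Injective q) (T : Finset κ) :
    ∃ π ∈ wordPerms S H, ∀ j ∈ T, π (p j) = q j := by
  induction T using Finset.induction_on with
  | empty => exact ⟨1, one_mem _, by simp⟩
  | insert j₀ T hj ih =>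
    obtain ⟨π, hπ, h⟩ := ih
    have hm : π (p j₀) ∈ S := mem_of_fixes hπ.1 (hp j₀)
    refine ⟨swap (π (p j₀)) (q j₀) * π, mul_mem ?_ hπ, fun j hjT => ?_⟩
    · by_cases he : π (p j₀) = q j₀
      · rw [he, swap_self]
        exact one_mem _
      · exact (swap_mem_wordPerms hS hm (hq _)).2 (hH _ _ (hS hm (hq _) he))
    · rw [Perm.mul_apply]
      rcases Finset.mem_insert.1 hjT with rfl | hjT
      · rw [swap_apply_left]
      · have hne : j ≠ j₀ := fun h => hj (h ▸ hjT)
        rw [swap_apply_of_ne_of_ne, h j hjT]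
        · exact fun h' => hne (hpi (π.injective h'))
        · rw [h j hjT]
          exact fun h' => hne (hqi h')

/-- Surjectivity forces `v` to be empty. -/
theorem eq_one_of_sends_nil (hn : 2 ≤ n) {g : Perm (Cantor n)} {v : Word n} (h : Sends g [] v) :
    g = 1 := by
  rcases v with _ | ⟨a, t⟩
  · ext1 x
    have := h x
    rwa [app_nil] at this
  · exfalso
    have : Nontrivial (Fin n) := Fin.nontrivial_iff_two_le.2 hn
    obtain ⟨b, hb⟩ := exists_ne a
    obtain ⟨x, hx⟩ := g.surjective fun _ => b
    have h1 := h x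
    rw [app_nil, hx] at h1
    have h2 := congrFun h1 0
    rw [app_cons_zero] at h2
    exact hb h2

theorem IsBasis.image (hn : 2 ≤ n) {A : Finset (Word n)} (hA : IsBasis A) {g : Perm (Cantor n)}
    {f : Word n → Word n} (hf : ∀ u ∈ A, Sends g u (f u)) :
    IsBasis (A.image f) ∧ Set.InjOn f A := by
  have w0 : Cantor n := fun _ => ⟨0, by omega⟩
  have hP := hA.pairwise_perp w0
  constructor
  · apply isBasis_of_pairwise
    · intro a ha b hb hab
      simp only [Finset.coe_image, Set.mem_image] at ha hb
      obtain ⟨a, ha, rfl⟩ := ha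
      obtain ⟨b, hb, rfl⟩ := hb
      exact (hf a ha).perp hn (hf b hb) (hP ha hb (by rintro rfl; exact hab rfl))
    · intro x
      obtain ⟨u, ⟨hu, w, hw⟩, -⟩ := hA (g⁻¹ x)
      refine ⟨f u, Finset.mem_image_of_mem f hu, w, ?_⟩
      rw [← hf u hu, hw, perm_apply_inv_self]
  · intro a ha b hb hab
    by_contra hne
    exact ((hf a ha).perp hn (hf b hb) (hP ha hb hne)).ne hab

/-- A subgroup that contains all transpositions of cones contains `V n`. -/
theorem V_le_of_swapIn (hn : 2 ≤ n) {H : Subgroup (Perm (Cantor n))}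
    (hH : ∀ a b : Word n, Perp a b → SwapIn H a b) : V n ≤ H := by
  have w0 : Cantor n := fun _ => ⟨0, by omega⟩
  -- Induction on the size of a basis on which `g` replaces prefixes. If `t` moves the images of the
  -- children of `u` to the children of some `v`, then `t * g` replaces `u` by `v` and so acts on
  -- the smaller basis with these children contracted.
  have key : ∀ k : ℕ, ∀ A : Finset (Word n), A.card = k → IsBasis A →
      ∀ g : Perm (Cantor n), (∀ u ∈ A, ∃ v, Sends g u v) → g ∈ H := by
    intro k
    induction k using Nat.strong_induction_on with
    | _ k ih =>
      intro A hk hA g hg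
      by_cases hA0 : A = {[]}
      · subst hA0
        obtain ⟨v, hv⟩ := hg [] (by simp)
        rw [eq_one_of_sends_nil hn hv]
        exact H.one_mem
      obtain ⟨u, hu⟩ := exists_children_mem w0 hA hA0
      choose! f hf using hg
      obtain ⟨hB, hfi⟩ := hA.image hn hf
      have hB0 : A.image f ≠ {[]} := by
        intro h
        have h1 := Finset.card_image_of_injOn hfi
        rw [h, Finset.card_singleton] at h1
        have h2 : 1 < A.card := Finset.one_lt_card.2
          ⟨u ++ [(⟨0, by omega⟩ : Fin n)], hu _, u ++ [(⟨1, by omega⟩ : Fin n)], hu _, by simp⟩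
        omega
      obtain ⟨v, hv⟩ := exists_children_mem w0 hB hB0
      obtain ⟨π, ⟨hπ, t, ht, hl⟩, hπv⟩ := exists_mem_wordPerms_apply_eq (hB.pairwise_perp w0) hH
        (p := fun j => f (u ++ [j])) (q := fun j => v ++ [j])
        (fun j => Finset.mem_image_of_mem f (hu j)) hv
        (fun i j h => by simpa using hfi (hu i) (hu j) h) (fun i j h => by simpa using h)
        Finset.univ
      rw [lifts_iff] at hl
      have hmem : t * g ∈ H := by
        refine ih _ (hk ▸ card_contract_lt hn hu) _ rfl (hA.contract w0 hu) _ fun a ha => ?_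
        simp only [Finset.mem_insert, Finset.mem_filter] at ha
        rcases ha with rfl | ha
        · refine ⟨v, sends_of_children fun j => ?_⟩
          rw [← hπv j (Finset.mem_univ _)]
          exact (hl.1 _ (Finset.mem_image_of_mem f (hu j))).mul (hf _ (hu j))
        · exact ⟨_, (hl.1 _ (Finset.mem_image_of_mem f ha.1)).mul (hf _ ha.1)⟩
      simpa using H.mul_mem (H.inv_mem ht) hmem
  intro g hg
  obtain ⟨N, hN⟩ := mem_V_iff.1 hg
  exact key _ _ rfl (isBasis_level n N) g fun u hu => hN u (mem_level.1 hu)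

end Transpositions

/-! ### The derived subgroup and the three-cycles of small cones -/

section DerivedSubgroup

variable {n : ℕ}

theorem exists_moves_swap {a b : Word n} (h : Perp a b) :
    ∃ t ∈ V n, Moves ![a, b] ![b, a] t := by
  have hS : ({a, b} : Set (Word n)).Pairwise Perp := by
    rw [Set.pairwise_pair]
    exact fun _ => ⟨h, h.symm⟩
  obtain ⟨t, ht⟩ := exists_lifts hS (swap_fixes (a := a) (b := b) (by simp) (by simp))
  exact ⟨t, ht.mem_V (by simp), (lifts_swap_iff hS (by simp) (by simp)).1 ht⟩

theorem pairwise_perp_triple {a b c : Word n} (hab : Perp a b) (hbc : Perp b c) (hac : Perp a c) :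
    ({a, b, c} : Set (Word n)).Pairwise Perp := by
  rintro x (rfl | rfl | rfl) y (rfl | rfl | rfl) hne
  all_goals first | exact absurd rfl hne | assumption | (apply Perp.symm; assumption)

theorem pairwise_perp_vec {a b c : Word n} (hab : Perp a b) (hbc : Perp b c) (hac : Perp a c) :
    Pairwise fun i j => Perp ((![a, b, c] : Fin 3 → Word n) i) ((![a, b, c] : Fin 3 → Word n) j) := by
  intro i j hij
  fin_cases i <;> fin_cases j <;> simp at hij ⊢ <;>
    first | assumption | (apply Perp.symm; assumption)

theorem vec_rotate {a b c : Word n} :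
    ∀ i, ∃ i', (![b, c, a] : Fin 3 → Word n) i = (![a, b, c] : Fin 3 → Word n) i' := by
  intro i
  fin_cases i
  exacts [⟨1, rfl⟩, ⟨2, rfl⟩, ⟨0, rfl⟩]

theorem TriIn.of_descendants {H : Subgroup (Perm (Cantor n))} {a b c : Word n} (hab : Perp a b)
    (hbc : Perp b c) (hac : Perp a c) (k : ℕ)
    (h : ∀ s : Word n, s.length = k → TriIn H (a ++ s) (b ++ s) (c ++ s)) : TriIn H a b c := by
  refine Has.of_descendants k (pairwise_perp_vec hab hbc hac) vec_rotate fun s hs => ?_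
  convert (show Has H ![a ++ s, b ++ s, c ++ s] ![b ++ s, c ++ s, a ++ s] from h s hs) using 1
  all_goals ext1 i; fin_cases i <;> rfl

theorem SwapIn.of_descendants {H : Subgroup (Perm (Cantor n))} {a b : Word n} (hab : Perp a b)
    (k : ℕ) (h : ∀ s : Word n, s.length = k → SwapIn H (a ++ s) (b ++ s)) : SwapIn H a b := by
  refine Has.of_descendants k ?_ ?_ fun s hs => ?_
  · intro i j hij
    fin_cases i <;> fin_cases j <;> simp at hij ⊢ <;>
      first | assumption | (apply Perp.symm; assumption)
  · intro i
    fin_cases i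
    exacts [⟨1, rfl⟩, ⟨0, rfl⟩]
  convert (show Has H ![a ++ s, b ++ s] ![b ++ s, a ++ s] from h s hs) using 1
  all_goals ext1 i; fin_cases i <;> rfl

/-- The derived subgroup of `V n`, as a group of permutations of the Cantor space. -/
def derivedV (n : ℕ) : Subgroup (Perm (Cantor n)) := (commutator (V n)).map (V n).subtype

theorem commutatorElement_mem_derivedV {g h : Perm (Cantor n)} (hg : g ∈ V n) (hh : h ∈ V n) :
    g * h * g⁻¹ * h⁻¹ ∈ derivedV n :=
  ⟨⁅(⟨g, hg⟩ : V n), ⟨h, hh⟩⁆, Subgroup.commutator_mem_commutator (Subgroup.mem_top _)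
    (Subgroup.mem_top _), rfl⟩

/-- The commutator of the transpositions `(a b)` and `(b c)` is the square of `(a b c)`, which is
its inverse. -/
theorem triIn_derivedV {a b c : Word n} (hab : Perp a b) (hbc : Perp b c) (hac : Perp a c) :
    TriIn (derivedV n) a b c := by
  have hS := pairwise_perp_triple hab hbc hac
  rw [← tri_mem_wordPerms hS (by simp) (by simp) (by simp) hab.ne hbc.ne hac.ne]
  obtain ⟨g, hg⟩ := exists_lifts hS (swap_fixes (a := a) (b := b) (by simp) (by simp))
  obtain ⟨h, hh⟩ := exists_lifts hS (swap_fixes (a := b) (b := c) (by simp) (by simp))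
  have fx := swap_fixes (S := {a, b, c}) (a := a) (b := b) (by simp) (by simp)
  have fy := swap_fixes (S := {a, b, c}) (a := b) (b := c) (by simp) (by simp)
  have h1 := ((hg.mul fy hh).mul (inv_fixes fx) (hg.inv fx)).mul (inv_fixes fy) (hh.inv fy)
  have h2 : swap a b * swap b c * (swap a b)⁻¹ * (swap b c)⁻¹ = (tri a b c)⁻¹ := by
    have h3 : tri a b c * tri a b c * tri a b c = 1 := by
      have e : tri a b c * tri a b c = (tri a b c)⁻¹ := by
        rw [tri_inv]
        refine eq_tri hbc.ne.symm hab.ne.symm hac.ne.symm ?_ ?_ ?_ ?_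
        · rw [Perm.mul_apply, tri_apply_right, tri_apply_left hab.ne hac.ne]
        · rw [Perm.mul_apply, tri_apply_mid hbc.ne hac.ne, tri_apply_right]
        · rw [Perm.mul_apply, tri_apply_left hab.ne hac.ne, tri_apply_mid hbc.ne hac.ne]
        · intro x h1 h2 h3
          rw [Perm.mul_apply, tri_apply_of_ne h3 h2 h1, tri_apply_of_ne h3 h2 h1]
      rw [e, inv_mul_cancel]
    rw [swap_inv, swap_inv, mul_assoc, eq_inv_iff_mul_eq_one]
    exact h3
  have h4 : (tri a b c)⁻¹ ∈ wordPerms {a, b, c} (derivedV n) := by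
    rw [← h2]
    refine ⟨?_, _, commutatorElement_mem_derivedV (hg.mem_V (by simp)) (hh.mem_V (by simp)), h1⟩
    rw [h2]
    exact inv_fixes (tri_fixes (by simp) (by simp) (by simp))
  exact (Subgroup.inv_mem_iff _).1 h4

/-- Two distinct transpositions of disjoint cones differ by an element of any subgroup that
contains enough three-cycles. -/
theorem swap_inv_mul_swap_mem_of_perp {K : Subgroup (Perm (Cantor n))} {a b c d : Word n}
    (hS : ({a, b, c, d} : Set (Word n)).Pairwise Perp) (hab : a ≠ b) (hbc : b ≠ c) (hac : a ≠ c)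
    (hcd : c ≠ d) (hbd : b ≠ d) (h1 : TriIn K a b c) (h2 : TriIn K b c d)
    {t t' : Perm (Cantor n)} (ht : Moves ![a, b] ![b, a] t) (ht' : Moves ![c, d] ![d, c] t') :
    t⁻¹ * t' ∈ K := by
  rw [← tri_mem_wordPerms hS (by simp) (by simp) (by simp) hab hbc hac] at h1
  rw [← tri_mem_wordPerms hS (by simp) (by simp) (by simp) hbc hcd hbd] at h2
  rw [← lifts_swap_iff hS (by simp) (by simp)] at ht ht'
  have h3 := mul_mem h1 h2
  -- `(a b c)(b c d) = (a b)(c d)`, the two middle transpositions cancelling.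
  have h4 : tri a b c * tri b c d = (swap a b)⁻¹ * swap c d := by
    simp only [tri, swap_inv]
    rw [mul_assoc, ← mul_assoc (swap b c) (swap b c), swap_mul_self, one_mul]
  rw [h4] at h3
  exact mem_of_lifts h3 ((ht.inv (swap_fixes (by simp) (by simp))).mul
    (swap_fixes (by simp) (by simp)) ht')

/-- There are at least eight words of length three, and the words of `F` begin with at most four of
them. Two unused ones are prolonged to length at least `L`. -/
theorem exists_perp_pair (hn : 2 ≤ n) (F : Finset (Word n)) (hF : F.card ≤ 4) (L : ℕ)
    (hL : ∀ u ∈ F, 3 ≤ u.length) : ∃ e f : Word n, L ≤ e.length ∧ L ≤ f.length ∧ Perp e f ∧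
      ∀ u ∈ F, Perp u e ∧ Perp u f := by
  have h1 : (F.image (List.take 3)).card ≤ 4 := Finset.card_image_le.trans hF
  have h2 : 8 ≤ (level n 3).card := by
    rw [level, Finset.card_image_of_injective _ List.ofFn_injective, Finset.card_univ,
      Fintype.card_fun, Fintype.card_fin, Fintype.card_fin]
    calc 8 = 2 ^ 3 := by norm_num
      _ ≤ n ^ 3 := Nat.pow_le_pow_left hn 3
  have h3 : 1 < (level n 3 \ F.image (List.take 3)).card := by
    have := Finset.le_card_sdiff (F.image (List.take 3)) (level n 3)
    omega
  obtain ⟨p, hp, q, hq, hpq⟩ := Finset.one_lt_card.1 h3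
  rw [Finset.mem_sdiff, mem_level] at hp hq
  have key : ∀ p : Word n, p.length = 3 → p ∉ F.image (List.take 3) → ∀ u ∈ F, Perp u p := by
    intro p hp hpF u hu
    refine (perp_of_length_eq (u := u.take 3) (by rw [hp, List.length_take]; have := hL u hu; omega)
      fun h => hpF (Finset.mem_image.2 ⟨u, hu, h⟩)).mono (List.take_prefix _ _)
      (List.prefix_refl _)
  have z : Fin n := ⟨0, by omega⟩
  refine ⟨p ++ List.replicate L z, q ++ List.replicate L z, by simp, by simp,
    (perp_of_length_eq (hp.1.trans hq.1.symm) hpq).mono (List.prefix_append _ _)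
      (List.prefix_append _ _), fun u hu => ⟨?_, ?_⟩⟩
  · exact (key p hp.1 hp.2 u hu).mono (List.prefix_refl _) (List.prefix_append _ _)
  · exact (key q hq.1 hq.2 u hu).mono (List.prefix_refl _) (List.prefix_append _ _)

/-- The cones of `a`, `b` may meet those of `c`, `d`, so both transpositions are compared with a
third one, of cones `e` and `f` disjoint from all four. -/
theorem swap_inv_mul_swap_mem (hn : 2 ≤ n) {K : Subgroup (Perm (Cantor n))} {L : ℕ} (hL : 3 ≤ L)
    (hK : ∀ a b c : Word n, L ≤ a.length → L ≤ b.length → L ≤ c.length → Perp a b → Perp b c →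
      Perp a c → TriIn K a b c) {a b c d : Word n} (ha : L ≤ a.length) (hb : L ≤ b.length)
    (hc : L ≤ c.length) (hd : L ≤ d.length) (hab : Perp a b) (hcd : Perp c d)
    {t t' : Perm (Cantor n)} (ht : Moves ![a, b] ![b, a] t) (ht' : Moves ![c, d] ![d, c] t') :
    t⁻¹ * t' ∈ K := by
  obtain ⟨e, f, he, hf, hef, h⟩ := exists_perp_pair hn {a, b, c, d} Finset.card_le_four L (by
    intro u hu
    simp only [Finset.mem_insert, Finset.mem_singleton] at hu
    rcases hu with rfl | rfl | rfl | rfl <;> omega)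
  obtain ⟨s, -, hs⟩ := exists_moves_swap hef
  have hae := h a (by simp)
  have hbe := h b (by simp)
  have hce := h c (by simp)
  have hde := h d (by simp)
  have key : ∀ {a b : Word n} {t}, L ≤ a.length → L ≤ b.length → Perp a b →
      (Perp a e ∧ Perp a f) → (Perp b e ∧ Perp b f) → Moves ![a, b] ![b, a] t → t⁻¹ * s ∈ K := by
    intro a b t ha hb hab ha' hb' ht
    refine swap_inv_mul_swap_mem_of_perp ?_ hab.ne hb'.1.ne ha'.1.ne hef.ne hb'.2.ne
      (hK _ _ _ ha hb he hab hb'.1 ha'.1) (hK _ _ _ hb he hf hb'.1 hef hb'.2) ht hs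
    rintro x (rfl | rfl | rfl | rfl) y (rfl | rfl | rfl | rfl) hne
    all_goals first
      | exact absurd rfl hne | exact hab | exact hab.symm | exact hef | exact hef.symm
      | exact ha'.1 | exact ha'.2 | exact hb'.1 | exact hb'.2 | exact ha'.1.symm
      | exact ha'.2.symm | exact hb'.1.symm | exact hb'.2.symm
  have h1 := key ha hb hab hae hbe ht
  have h2 := key hc hd hcd hce hde ht'
  have h3 := K.mul_mem h1 (K.inv_mem h2)
  simpa [mul_assoc] using h3

/-- A subgroup that contains all three-cycles of small cones contains the derived subgroup. -/
theorem derivedV_le_of_triIn (hn : 2 ≤ n) {H : Subgroup (Perm (Cantor n))} {L : ℕ} (hL : 3 ≤ L)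
    (hH : ∀ a b c : Word n, L ≤ a.length → L ≤ b.length → L ≤ c.length → Perp a b → Perp b c →
      Perp a c → TriIn H a b c) : derivedV n ≤ H := by
  set gens : Set (Perm (Cantor n)) := {h | ∃ a b c : Word n, L ≤ a.length ∧ L ≤ b.length ∧
    L ≤ c.length ∧ Perp a b ∧ Perp b c ∧ Perp a c ∧ Moves ![a, b, c] ![b, c, a] h} with hgens
  set K := Subgroup.closure gens with hKdef
  have hKH : K ≤ H := by
    rw [hKdef, Subgroup.closure_le]
    rintro h ⟨a, b, c, ha, hb, hc, hab, hbc, hac, hm⟩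
    exact (hH a b c ha hb hc hab hbc hac).mem hm
  have hK : ∀ a b c : Word n, L ≤ a.length → L ≤ b.length → L ≤ c.length → Perp a b → Perp b c →
      Perp a c → TriIn K a b c := by
    intro a b c ha hb hc hab hbc hac
    obtain ⟨h, -, hm⟩ := hH a b c ha hb hc hab hbc hac
    exact ⟨h, Subgroup.subset_closure ⟨a, b, c, ha, hb, hc, hab, hbc, hac, hm⟩, hm⟩
  -- `K` is normalized by `V n`: after subdivision `v` replaces the prefixes involved by words that
  -- again have length at least `L`, so it carries generators to generators.
  have hnorm : ∀ v ∈ V n, ∀ k ∈ K, v * k * v⁻¹ ∈ K := by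
    intro v hv
    have hle : K ≤ K.comap (MulAut.conj v).toMonoidHom := by
      conv_lhs => rw [hKdef]
      rw [Subgroup.closure_le]
      rintro h ⟨a, b, c, ha, hb, hc, hab, hbc, hac, hm⟩
      obtain ⟨N, hN⟩ := exists_sends_of_mem_V hv L
      refine Has.mem ?_ hm
      refine TriIn.of_descendants hab hbc hac N fun s hs => ?_
      obtain ⟨a', ha', hla⟩ := hN (a ++ s) (by simp; omega)
      obtain ⟨b', hb', hlb⟩ := hN (b ++ s) (by simp; omega)
      obtain ⟨c', hc', hlc⟩ := hN (c ++ s) (by simp; omega)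
      have pab : Perp (a ++ s) (b ++ s) := hab.mono (List.prefix_append _ _) (List.prefix_append _ _)
      have pbc : Perp (b ++ s) (c ++ s) := hbc.mono (List.prefix_append _ _) (List.prefix_append _ _)
      have pac : Perp (a ++ s) (c ++ s) := hac.mono (List.prefix_append _ _) (List.prefix_append _ _)
      obtain ⟨k, hk, hkm⟩ := hK (a ++ s) (b ++ s) (c ++ s) (by simp; omega) (by simp; omega)
        (by simp; omega) pab pbc pac
      refine ⟨k, Subgroup.subset_closure ?_, hkm⟩
      refine ⟨a', b', c', hla, hlb, hlc, ha'.perp hn hb' pab, hb'.perp hn hc' pbc,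
        ha'.perp hn hc' pac, ?_⟩
      refine hkm.conj ?_ ?_
      · simp [Fin.forall_fin_succ, ha', hb', hc']
      · simp [Fin.forall_fin_succ, ha', hb', hc']
    intro k hk
    exact hle hk
  have hN : (K.subgroupOf (V n)).Normal :=
    ⟨fun k hk v => hnorm v v.2 k hk⟩
  obtain ⟨e, f, he, hf, hef, -⟩ := exists_perp_pair hn ∅ (by simp) L (by simp)
  obtain ⟨t₀, ht₀V, ht₀⟩ := exists_moves_swap hef
  set Q := V n ⧸ K.subgroupOf (V n)
  let q : Q := QuotientGroup.mk (⟨t₀, ht₀V⟩ : V n)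
  let X : Subgroup (V n) := (Subgroup.zpowers q).comap (QuotientGroup.mk' _)
  -- Every transposition of cones is a product of transpositions of small cones, and these all
  -- represent `q` modulo `K`. Hence the quotient is cyclic, so abelian.
  have hX : V n ≤ X.map (V n).subtype := by
    refine V_le_of_swapIn hn fun a b hab => SwapIn.of_descendants hab L fun s hs => ?_
    have pab : Perp (a ++ s) (b ++ s) := hab.mono (List.prefix_append _ _) (List.prefix_append _ _)
    obtain ⟨t, htV, ht⟩ := exists_moves_swap pab
    refine ⟨t, ⟨⟨t, htV⟩, ?_, rfl⟩, ht⟩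
    have : (QuotientGroup.mk (⟨t, htV⟩ : V n) : Q) = q := by
      rw [QuotientGroup.eq]
      exact swap_inv_mul_swap_mem hn hL hK (by simp; omega) (by simp; omega) he hf pab hef ht ht₀
    change (QuotientGroup.mk (⟨t, htV⟩ : V n) : Q) ∈ Subgroup.zpowers q
    rw [this]
    exact Subgroup.mem_zpowers q
  have hz : ∀ x : Q, x ∈ Subgroup.zpowers q := by
    intro x
    obtain ⟨v, rfl⟩ := QuotientGroup.mk_surjective x
    obtain ⟨v', hv', h⟩ := hX v.2
    obtain rfl : v' = v := Subtype.ext h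
    exact hv'
  have hcomm : commutator (V n) ≤ K.subgroupOf (V n) := by
    rw [← Subgroup.Normal.quotient_commutative_iff_commutator_le]
    refine ⟨⟨fun x y => ?_⟩⟩
    obtain ⟨i, rfl⟩ := hz x
    obtain ⟨j, rfl⟩ := hz y
    exact (Commute.refl q).zpow_zpow i j
  rintro _ ⟨v, hv, rfl⟩
  exact hKH (hcomm hv)

/-- A subgroup that contains the derived subgroup and a transposition contains `V n`. -/
theorem V_le_of_derivedV_le (hn : 2 ≤ n) {H : Subgroup (Perm (Cantor n))} (hH : derivedV n ≤ H)
    {a b : Word n} (ha : 3 ≤ a.length) (hb : 3 ≤ b.length) (hab : Perp a b) (hs : SwapIn H a b) :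
    V n ≤ H := by
  obtain ⟨t, ht, hm⟩ := hs
  refine V_le_of_swapIn hn fun c d hcd => SwapIn.of_descendants hcd 3 fun s hs => ?_
  have pcd : Perp (c ++ s) (d ++ s) := hcd.mono (List.prefix_append _ _) (List.prefix_append _ _)
  obtain ⟨t', -, hm'⟩ := exists_moves_swap pcd
  refine ⟨t', ?_, hm'⟩
  -- Modulo the derived subgroup all transpositions of small cones agree with the given one.
  have := swap_inv_mul_swap_mem hn (K := H) le_rfl (fun a b c _ _ _ hab hbc hac =>
    (triIn_derivedV hab hbc hac).mono hH) ha hb (by simp [hs]) (by simp [hs]) hab pcd hm hm'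
  simpa using H.mul_mem ht this

end DerivedSubgroup

/-! ### From the three-cycles on one antichain to those of all small cones -/

section Descent

variable {n : ℕ}

theorem TriIn.of_conj {H : Subgroup (Perm (Cantor n))} {a b c a' b' c' : Word n}
    (hH : TriIn H a' b' c') {g : Perm (Cantor n)} (hg : g ∈ H) (ha : Sends g a a')
    (hb : Sends g b b') (hc : Sends g c c') : TriIn H a b c :=
  hH.conj (H.inv_mem hg) ha.inv hb.inv hc.inv

/-- The three-cycle of `a ++ [i]`, `b`, `c` takes `a ++ i :: s` to `b ++ s`, one letter shorter.
With `b` and `c` different from `a`, `v₀`, `w₀`, which `5 ≤ A.card` permits, it fixes `v` and `w` or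
shortens them too. -/
theorem exists_shorter_triIn (hn : 2 ≤ n) {H : Subgroup (Perm (Cantor n))} {A : Finset (Word n)}
    (hA : (A : Set (Word n)).Pairwise Perp) {N : ℕ} (hN : ∀ a ∈ A, a.length = N) (h5 : 5 ≤ A.card)
    (h2 : ∀ a ∈ A, ∀ b ∈ A, ∀ c ∈ A, ∀ i, a ≠ b → b ≠ c → a ≠ c → TriIn H (a ++ [i]) b c)
    {a v₀ w₀ : Word n} (ha : a ∈ A) (hv₀ : v₀ ∈ A) (hw₀ : w₀ ∈ A) (i : Fin n) (s v w : Word n)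
    (hv : v₀ <+: v) (hw : w₀ <+: w) (huv : Perp (a ++ i :: s) v) (hvw : Perp v w)
    (huw : Perp (a ++ i :: s) w) :
    ∃ u' v' w', (∃ x ∈ A, x <+: u') ∧ (∃ x ∈ A, x <+: v') ∧ (∃ x ∈ A, x <+: w') ∧ Perp u' v' ∧
      Perp v' w' ∧ Perp u' w' ∧ u'.length < (a ++ i :: s).length ∧ v'.length ≤ v.length ∧
      w'.length ≤ w.length ∧ (TriIn H u' v' w' → TriIn H (a ++ i :: s) v w) := by
  have h1 : 1 < (A \ {a, v₀, w₀}).card := by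
    have := Finset.le_card_sdiff ({a, v₀, w₀} : Finset (Word n)) A
    have := Finset.card_le_three (a := a) (b := v₀) (c := w₀)
    omega
  obtain ⟨b, hb, c, hc, hbc⟩ := Finset.one_lt_card.1 h1
  simp only [Finset.mem_sdiff, Finset.mem_insert, Finset.mem_singleton, not_or] at hb hc
  obtain ⟨hb, hba, hbv, hbw⟩ := hb
  obtain ⟨hc, hca, hcv, hcw⟩ := hc
  obtain ⟨k, hk, k1, k2, k3, k4⟩ := (h2 a ha b hb c hc i (Ne.symm hba) hbc (Ne.symm hca)).exists_sends
  have hsplit : a ++ i :: s = (a ++ [i]) ++ s := by simp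
  have hu : Sends k (a ++ i :: s) (b ++ s) := by
    rw [hsplit]
    exact k1.append s
  have key : ∀ v₀ ∈ A, b ≠ v₀ → c ≠ v₀ → ∀ v, v₀ <+: v → Perp (a ++ i :: s) v →
      ∃ v', Sends k v v' ∧ v'.length ≤ v.length ∧ ∃ x ∈ A, x <+: v' := by
    intro v₀ hv₀ hbv hcv v hv hp
    have pb : Perp v b := (hA hv₀ hb (Ne.symm hbv)).mono hv (List.prefix_refl _)
    have pc : Perp v c := (hA hv₀ hc (Ne.symm hcv)).mono hv (List.prefix_refl _)
    by_cases hpa : Perp v (a ++ [i])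
    · exact ⟨v, k4 v hpa pb pc, le_rfl, v₀, hv₀, hv⟩
    -- A prefix of `a ++ [i]` would be a prefix of `a ++ i :: s`, which is incomparable with `v`.
    · have h3 : a ++ [i] <+: v := by
        by_contra h3
        apply hpa
        refine ⟨fun h4 => hp.2 (h4.trans ?_), h3⟩
        rw [hsplit]
        exact List.prefix_append _ _
      obtain ⟨t, rfl⟩ := h3
      exact ⟨b ++ t, k1.append t, by simp [hN b hb, hN a ha], b, hb, List.prefix_append _ _⟩
  obtain ⟨v', kv, lv, xv⟩ := key v₀ hv₀ hbv hcv v hv huv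
  obtain ⟨w', kw, lw, xw⟩ := key w₀ hw₀ hbw hcw w hw huw
  refine ⟨b ++ s, v', w', ⟨b, hb, List.prefix_append _ _⟩, xv, xw, hu.perp hn kv huv,
    kv.perp hn kw hvw, hu.perp hn kw huw, ?_, lv, lw, fun h => h.of_conj hk hu kv kw⟩
  simp [hN b hb, hN a ha]

/-- Let `H` contain the three-cycles of the cones of words of an antichain `A`, and the
three-cycles of two such cones and a child of a third. Then `H` contains all three-cycles of
smaller cones. -/
theorem triIn_of_prefix_mem (hn : 2 ≤ n) {H : Subgroup (Perm (Cantor n))} {A : Finset (Word n)}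
    (hA : (A : Set (Word n)).Pairwise Perp) {N : ℕ} (hN : ∀ a ∈ A, a.length = N)
    (h5 : 5 ≤ A.card)
    (h1 : ∀ a ∈ A, ∀ b ∈ A, ∀ c ∈ A, a ≠ b → b ≠ c → a ≠ c → TriIn H a b c)
    (h2 : ∀ a ∈ A, ∀ b ∈ A, ∀ c ∈ A, ∀ i, a ≠ b → b ≠ c → a ≠ c → TriIn H (a ++ [i]) b c)
    (u v w : Word n) (hu : ∃ a ∈ A, a <+: u) (hv : ∃ a ∈ A, a <+: v) (hw : ∃ a ∈ A, a <+: w)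
    (huv : Perp u v) (hvw : Perp v w) (huw : Perp u w) : TriIn H u v w := by
  have key : ∀ M : ℕ, ∀ u v w : Word n, u.length + v.length + w.length ≤ M →
      (∃ a ∈ A, a <+: u) → (∃ a ∈ A, a <+: v) → (∃ a ∈ A, a <+: w) →
      Perp u v → Perp v w → Perp u w → TriIn H u v w := by
    intro M
    induction M with
    | zero =>
      intro u v w hM _ _ _ huv
      have hu : u = [] := List.length_eq_zero_iff.1 (by omega)
      exact absurd (hu ▸ List.nil_prefix) huv.1
    | succ M ih =>
      have step : ∀ u v w : Word n, u.length + v.length + w.length ≤ M + 1 →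
          (∃ a ∈ A, a <+: u) → (∃ a ∈ A, a <+: v) → (∃ a ∈ A, a <+: w) →
          Perp u v → Perp v w → Perp u w → u ∈ A ∨ TriIn H u v w := by
        rintro u v w hM ⟨a, ha, t, rfl⟩ ⟨v₀, hv₀, hv⟩ ⟨w₀, hw₀, hw⟩ huv hvw huw
        rcases t with _ | ⟨i, s⟩
        · left
          rwa [List.append_nil]
        · right
          obtain ⟨u', v', w', xu, xv, xw, p1, p2, p3, l1, l2, l3, h⟩ :=
            exists_shorter_triIn hn hA hN h5 h2 ha hv₀ hw₀ i s v w hv hw huv hvw huw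
          exact h (ih u' v' w' (by omega) xu xv xw p1 p2 p3)
      intro u v w hM hu hv hw huv hvw huw
      -- By rotation each of the three words can be the one that is shortened. If none lies strictly
      -- below `A`, all are words of `A`.
      rcases step u v w hM hu hv hw huv hvw huw with hu' | h
      swap
      · exact h
      rcases step v w u (by omega) hv hw hu hvw huw.symm huv.symm with hv' | h
      swap
      · exact h.rotate.rotate
      rcases step w u v (by omega) hw hu hv huw.symm huv hvw.symm with hw' | h
      swap
      · exact h.rotate
      exact h1 u hu' v hv' w hw' huv.ne hvw.ne huw.ne
  exact key _ u v w le_rfl hu hv hw huv hvw huw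

/-- In the presence of all three-cycles of the cones of `A`, the children of a single word of `A`
suffice. -/
theorem triIn_child_of_full {H : Subgroup (Perm (Cantor n))} {A : Finset (Word n)}
    (h5 : 5 ≤ A.card)
    (hF : Full (wordPerms (A : Set (Word n)) H) A) {a' : Word n} (ha' : a' ∈ A)
    (h : ∀ b ∈ A, ∀ c ∈ A, ∀ i, a' ≠ b → b ≠ c → a' ≠ c → TriIn H (a' ++ [i]) b c) :
    ∀ a ∈ A, ∀ b ∈ A, ∀ c ∈ A, ∀ i, a ≠ b → b ≠ c → a ≠ c → TriIn H (a ++ [i]) b c := by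
  intro a ha b hb c hc i hab hbc hac
  by_cases haa : a = a'
  · subst haa
    exact h b hb c hc i hab hbc hac
  -- A third word `x` gives an element of `H` that lifts `(a' a x)`, hence replaces `a'` by `a`
  -- together with its children.
  obtain ⟨x, hx⟩ : (A \ {a, a'}).Nonempty := by
    rw [← Finset.card_pos]
    have := Finset.le_card_sdiff ({a, a'} : Finset (Word n)) A
    have := Finset.card_le_two (a := a) (b := a')
    omega
  simp only [Finset.mem_sdiff, Finset.mem_insert, Finset.mem_singleton, not_or] at hx
  have hτ := hF a' ha' a ha x hx.1 (Ne.symm haa) (Ne.symm hx.2.1) (Ne.symm hx.2.2)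
  set τ := tri a' a x with hτdef
  have hτa : τ a' = a := tri_apply_left (Ne.symm haa) (Ne.symm hx.2.2)
  obtain ⟨hfix, k, hk, hl⟩ := hτ
  rw [lifts_iff] at hl
  have hmem : ∀ y ∈ A, τ⁻¹ y ∈ A := fun y hy => mem_of_fixes (inv_fixes hfix) hy
  have hs : ∀ y ∈ A, Sends k (τ⁻¹ y) y := by
    intro y hy
    have := hl.1 _ (hmem y hy)
    rwa [perm_apply_inv_self] at this
  have hne : ∀ y, a ≠ y → a' ≠ τ⁻¹ y := by
    rintro y hay he
    rw [he, perm_apply_inv_self] at hτa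
    exact hay hτa.symm
  have h3 := h _ (hmem b hb) _ (hmem c hc) i (hne b hab) (fun he => hbc (τ⁻¹.injective he))
    (hne c hac)
  have h4 := hl.1 a' ha'
  rw [hτa] at h4
  exact h3.conj hk (h4.append [i]) (hs b hb) (hs c hc)

/-- There are at least four words of length `k ≥ 2`, and each of `v`, `w` excludes at most one. -/
theorem exists_two_not_prefix (hn : 2 ≤ n) (k : ℕ) (hk : 2 ≤ k) (e v w : Word n)
    (hv : e.length + k ≤ v.length) (hw : e.length + k ≤ w.length) :
    ∃ p q : Word n, p.length = k ∧ q.length = k ∧ p ≠ q ∧ Perp (e ++ p) v ∧ Perp (e ++ p) w ∧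
      Perp (e ++ q) v ∧ Perp (e ++ q) w := by
  have h2 : 4 ≤ (level n k).card := by
    rw [level, Finset.card_image_of_injective _ List.ofFn_injective, Finset.card_univ,
      Fintype.card_fun, Fintype.card_fin, Fintype.card_fin]
    calc 4 = 2 ^ 2 := by norm_num
      _ ≤ 2 ^ k := Nat.pow_le_pow_right (by norm_num) hk
      _ ≤ n ^ k := Nat.pow_le_pow_left hn k
  have h3 : 1 < (level n k \ {(v.drop e.length).take k, (w.drop e.length).take k}).card := by
    have := Finset.le_card_sdiff
      ({(v.drop e.length).take k, (w.drop e.length).take k} : Finset (Word n)) (level n k)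
    have := Finset.card_le_two (a := (v.drop e.length).take k) (b := (w.drop e.length).take k)
    omega
  obtain ⟨p, hp, q, hq, hpq⟩ := Finset.one_lt_card.1 h3
  simp only [Finset.mem_sdiff, Finset.mem_insert, Finset.mem_singleton, not_or, mem_level] at hp hq
  have key : ∀ p v : Word n, p.length = k → e.length + k ≤ v.length →
      p ≠ (v.drop e.length).take k → Perp (e ++ p) v := by
    intro p v hp hv hne
    have h4 : ¬ e ++ p <+: v := by
      rintro ⟨t, rfl⟩
      apply hne
      rw [List.append_assoc, List.drop_left, ← hp, List.take_left]
    refine ⟨h4, fun h5 => h4 ?_⟩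
    rw [h5.eq_of_length (le_antisymm h5.length_le (by simp; omega))]
  exact ⟨p, q, hp.1, hq.1, hpq, key p v hp.1 hv hp.2.1, key p w hp.1 hw hp.2.2,
    key q v hq.1 hv hq.2.1, key q w hq.1 hw hq.2.2⟩

/-- If `H` contains the three-cycles of small cones outside the cone of `d`, and an element that
moves the cone of `d` off itself, then `H` contains the derived subgroup. -/
theorem derivedV_le_of_outside (hn : 2 ≤ n) {H : Subgroup (Perm (Cantor n))}
    {g : Perm (Cantor n)} (hg : g ∈ H) {d d' e e' : Word n} (hd : Sends g d d')
    (he : Sends g e e') (hdd : Perp d d') (hde : Perp d e) (hde' : Perp d e') (N : ℕ)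
    (hH : ∀ u v w : Word n, N ≤ u.length → N ≤ v.length → N ≤ w.length → ¬ d <+: u → ¬ d <+: v →
      ¬ d <+: w → Perp u v → Perp v w → Perp u w → TriIn H u v w) : derivedV n ≤ H := by
  -- The `2` leaves room to avoid two given words below `e`; the `N` makes all words that arise long
  -- enough for `hH`.
  set k := N + 2 with hk
  have step : ∀ u v w : Word n, d.length + e.length + k ≤ u.length → e.length + k ≤ v.length →
      e.length + k ≤ w.length → Perp u v → Perp v w → Perp u w →
      ∃ o : Word n, e.length + k ≤ o.length ∧ ¬ d <+: o ∧ Perp o v ∧ Perp o w ∧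
        (TriIn H o v w → TriIn H u v w) := by
    intro u v w hu hv hw huv hvw huw
    by_cases hdu : d <+: u
    · obtain ⟨s, rfl⟩ := hdu
      obtain ⟨p, q, hp, hq, hpq, h1, h2, h3, h4⟩ :=
        exists_two_not_prefix hn k (by omega) e v w hv hw
      have dp : Perp (d ++ s) (e ++ p) := hde.mono (List.prefix_append _ _) (List.prefix_append _ _)
      have dq : Perp (d ++ s) (e ++ q) := hde.mono (List.prefix_append _ _) (List.prefix_append _ _)
      have pq : Perp (e ++ p) (e ++ q) :=
        perp_append_left.2 (perp_of_length_eq (hp.trans hq.symm) hpq)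
      have sp := he.append p
      have sq := he.append q
      have ss := hd.append s
      have hs : k ≤ s.length := by
        rw [List.length_append] at hu
        omega
      have under : ∀ x : Word n, Perp d x → ∀ t, ¬ d <+: x ++ t := fun x hx t =>
        (hx.mono (List.prefix_refl _) (List.prefix_append _ _)).1
      -- Conjugation by `g` turns this three-cycle into one whose cones all lie outside `d`. It then
      -- moves `d ++ s` to `e ++ p` while fixing the cones of `v` and `w`.
      have h5 : TriIn H (d ++ s) (e ++ p) (e ++ q) := by
        refine (hH (d' ++ s) (e' ++ p) (e' ++ q) ?_ ?_ ?_ (under _ hdd s) (under _ hde' p)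
          (under _ hde' q) (ss.perp hn sp dp) (sp.perp hn sq pq) (ss.perp hn sq dq)).of_conj hg
          ss sp sq <;> rw [List.length_append] <;> omega
      obtain ⟨κ, hκ, k1, -, -, k4⟩ := h5.exists_sends
      refine ⟨e ++ p, ?_, under _ hde p, h1, h2, fun h => h.of_conj hκ k1
        (k4 v huv.symm h1.symm h3.symm) (k4 w huw.symm h2.symm h4.symm)⟩
      rw [List.length_append, hp]
    · exact ⟨u, by omega, hdu, huv, huw, id⟩
  refine derivedV_le_of_triIn hn (L := d.length + e.length + k + 1) (by omega) ?_
  intro u v w hu hv hw huv hvw huw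
  -- The three words are moved out of the cone of `d` one after the other; a word already moved is
  -- long enough to be a companion in the next round.
  obtain ⟨o, lo, ho, ov, ow, h⟩ := step u v w (by omega) (by omega) (by omega) huv hvw huw
  apply h
  obtain ⟨p, lp, hp, pw, po, h⟩ := step v w o (by omega) (by omega) lo hvw ow.symm ov.symm
  apply TriIn.rotate
  apply TriIn.rotate
  apply h
  obtain ⟨q, lq, hq, qo, qp, h⟩ := step w o p (by omega) lo lp ow.symm po.symm pw.symm
  apply TriIn.rotate
  apply TriIn.rotate
  apply h
  exact hH q o p (by omega) (by omega) (by omega) hq ho hp qo po.symm qp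

end Descent

/-! ### Moving a cone off itself, and generating three-cycles from overlapping cycles -/

section Cycles

variable {n : ℕ}

theorem exists_perp_of_ne {x z : Cantor n} (h : x ≠ z) : ∃ j : ℕ, ∀ u v : Word n, x ∈ cone u →
    z ∈ cone v → j < u.length → j < v.length → Perp u v := by
  obtain ⟨j, hj⟩ := Function.ne_iff.1 h
  have key : ∀ u : Word n, j < u.length → x ∈ cone u → z ∉ cone u := by
    rintro u hu ⟨w, rfl⟩ ⟨w', rfl⟩
    exact hj (by simp [app, hu])
  exact ⟨j, fun u v hx hz hu hv => ⟨fun h => key u hu hx (cone_anti h hz),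
    fun h => key v hv (cone_anti h hx) hz⟩⟩

/-- A nontrivial element of `V n` moves some cone off itself, away from another cone and its
preimage. -/
theorem exists_sends_perp (hn : 2 ≤ n) {g : Perm (Cantor n)} (hg : g ∈ V n) (hg1 : g ≠ 1) :
    ∃ d d' e e' : Word n, Sends g d d' ∧ Sends g e e' ∧ Perp d d' ∧ Perp d e ∧ Perp d e' := by
  have : Nontrivial (Fin n) := Fin.nontrivial_iff_two_le.2 hn
  obtain ⟨x, hx⟩ : ∃ x, g x ≠ x := by
    by_contra! h
    exact hg1 (Equiv.ext h)
  -- With `y` different from `x` and `g⁻¹ x`, the point `x` differs from each of `g x`, `y` and `g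
  -- y`. Long prefixes of these points then separate them.
  obtain ⟨y, hy⟩ := (Set.toFinite ({x, g⁻¹ x} : Set (Cantor n))).exists_notMem
  simp only [Set.mem_insert_iff, Set.mem_singleton_iff, not_or] at hy
  have hgy : x ≠ g y := fun h => hy.2 (by rw [h, perm_inv_apply_self])
  obtain ⟨j₁, h1⟩ := exists_perp_of_ne (Ne.symm hx)
  obtain ⟨j₂, h2⟩ := exists_perp_of_ne (Ne.symm hy.1)
  obtain ⟨j₃, h3⟩ := exists_perp_of_ne hgy
  obtain ⟨N, hN⟩ := exists_sends_of_mem_V hg (j₁ + j₂ + j₃ + 1)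
  set k := N + j₁ + j₂ + j₃ + 1 with hk
  have hpre : ∀ x : Cantor n, ∃ u : Word n, u.length = k ∧ x ∈ cone u := fun x =>
    ⟨List.ofFn fun i : Fin k => x i, List.length_ofFn, _, app_take_drop k x⟩
  obtain ⟨d, ld, w, hw⟩ := hpre x
  obtain ⟨e, le, z, hz⟩ := hpre y
  obtain ⟨d', hd, ld'⟩ := hN d (by omega)
  obtain ⟨e', he, le'⟩ := hN e (by omega)
  refine ⟨d, d', e, e', hd, he, h1 d d' ⟨w, hw⟩ ⟨w, ?_⟩ (by omega) (by omega),
    h2 d e ⟨w, hw⟩ ⟨z, hz⟩ (by omega) (by omega), h3 d e' ⟨w, hw⟩ ⟨z, ?_⟩ (by omega) (by omega)⟩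
  · rw [← hd, hw]
  · rw [← he, hz]

theorem two_le_length {α : Type*} {L : List α} {a b : α} (ha : a ∈ L) (hb : b ∈ L) (hab : a ≠ b) :
    2 ≤ L.length := by
  match L with
  | [] => simp at ha
  | [c] =>
    simp only [List.mem_singleton] at ha hb
    exact absurd (ha.trans hb.symm) hab
  | _ :: _ :: _ => simp

theorem full_triple {α : Type*} [DecidableEq α] {K : Subgroup (Perm α)} {a b c : α} (hab : a ≠ b)
    (h : tri a b c ∈ K) : Full K {c, a, b} := by
  have h0 : Full K {a, b} := by
    rintro x (rfl | rfl) y (rfl | rfl) z (rfl | rfl) h1 h2 h3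
    all_goals first | exact absurd rfl h1 | exact absurd rfl h2 | exact absurd rfl h3
  exact h0.insert_of_mem (by simp) (by simp) hab h

/-- The permutations realized by `H` on an antichain `A` and on the antichain obtained by
replacing `a` by its children contain all three-cycles, if they contain suitable cycles. -/
theorem full_of_cycles {H : Subgroup (Perm (Cantor n))} {A : Set (Word n)} (hA : A.Pairwise Perp)
    {S : Set (Word n)} (hS : S.Pairwise Perp) {s s₁ s₂ a : Word n} (hs : s ∈ A) (hs₁ : s₁ ∈ A)
    (ha : a ∈ A) (h1 : s ≠ s₁) (h2 : s₁ ≠ s₂) (h3 : s ≠ s₂) (has : a ≠ s)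
    (has₁ : a ≠ s₁) (has₂ : a ≠ s₂)
    {W : Set (Word n)} {B Y : List (Word n)} (hBA : ∀ b ∈ B, b ∈ A) (hsB : s ∉ B) (hs₁B : s₁ ∉ B)
    (hs₂B : s₂ ∉ B) (haB : a ∉ B) (hWB : ∀ u ∈ W, u ∈ B) {b : Word n} (hb : b ∈ B) (hbW : b ∉ W)
    (hYn : Y.Nodup) (hY : ∀ u, u ∈ Y ↔ u ∈ A ∧ u ≠ s₁ ∧ u ≠ s₂ ∧ u ∉ W)
    (hAS : ∀ u ∈ A, u ≠ a → u ∈ S) (haS : ∀ i, a ++ [i] ∈ S) {Z : List (Word n)} (hZn : Z.Nodup)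
    (hZ : ∀ u, u ∈ Z ↔ u ∈ B ∨ ∃ i, u = a ++ [i]) (hZ2 : 2 ≤ Z.length)
    (hy : Y.formPerm ∈ wordPerms A H) (hx : tri s s₁ s₂ ∈ wordPerms A H)
    (hz : Z.formPerm ∈ wordPerms S H) :
    Full (wordPerms A H) A ∧
      ∀ b ∈ A, ∀ c ∈ A, ∀ i, a ≠ b → b ≠ c → a ≠ c → TriIn H (a ++ [i]) b c := by
  set y := Y.formPerm with hydef
  set x := tri s s₁ s₂ with hxdef
  set z := Z.formPerm with hzdef
  have haW : a ∉ W := fun h => haB (hWB _ h)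
  have hsW : s ∉ W := fun h => hsB (hWB _ h)
  have hs₁W : s₁ ∉ W := fun h => hs₁B (hWB _ h)
  have hsY : s ∈ Y := (hY s).2 ⟨hs, h1, h3, hsW⟩
  have haY : a ∈ Y := (hY a).2 ⟨ha, has₁, has₂, haW⟩
  have hs₁Y : s₁ ∉ Y := fun h => ((hY _).1 h).2.1 rfl
  have hs₂Y : s₂ ∉ Y := fun h => ((hY _).1 h).2.2.1 rfl
  have hys : y s ≠ s := formPerm_ne_self hYn (two_le_length hsY haY has.symm) hsY
  have hxs : x s = s₁ := tri_apply_left h1 h3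
  have hxs₁ : x s₁ = s₂ := tri_apply_mid h2 h3
  have hy₁ : y s₁ = s₁ := formPerm_fixes _ hs₁Y
  -- The only point moved by both `y` and `x` is `s`.
  have c1 : tri s (y s) s₁ ∈ wordPerms A H := by
    have := mul_mem (mul_mem (mul_mem hy hx) (inv_mem hy)) (inv_mem hx)
    rwa [commutator_eq_tri (b := s) ?_ hys (by rw [hxs]; exact h1.symm), hxs] at this
    intro u hyu hxu
    by_contra hus
    have huY : u ∈ Y := by
      by_contra h
      exact hyu (formPerm_fixes _ h)
    exact hxu (tri_apply_of_ne hus (by rintro rfl; exact hs₁Y huY) (by rintro rfl; exact hs₂Y huY))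
  have F1 := (full_triple hys.symm c1).orbit hy (b := s) (c := s₁) (by simp) (by simp) hys
    (by simp) hy₁
  -- The orbit of `s` under `y` is all of `Y`; that under `x` supplies `s₂`. Together with `s₁` this
  -- covers `A` except `W`.
  have F2 := F1.orbit hx (b := s) (c := a) (Or.inr ⟨0, rfl⟩) (by rw [hxs]; simp)
    (by rw [hxs]; exact h1.symm) (Or.inr (exists_formPerm_pow_eq hYn hsY haY))
    (tri_apply_of_ne has has₁ has₂)
  have F3 : Full (wordPerms A H) {u | u ∈ A ∧ u ∉ W} := by
    refine F2.subset ?_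
    rintro u ⟨huA, huW⟩
    by_cases hu1 : u = s₁
    · exact Or.inl (Or.inl (Or.inl hu1))
    by_cases hu2 : u = s₂
    · exact Or.inr ⟨2, by rw [hu2, pow_two, Perm.mul_apply, hxs, hxs₁]⟩
    · exact Or.inl (Or.inr (exists_formPerm_pow_eq hYn hsY ((hY u).2 ⟨huA, hu1, hu2, huW⟩)))
  -- Three-cycles of words common to both antichains pass from `A` to `S`.
  have F4 : Full (wordPerms S H) {u | u ∈ A ∧ u ∉ W ∧ u ≠ a} := by
    intro p hp q hq r hr hpq hqr hpr
    rw [tri_mem_wordPerms hS (hAS p hp.1 hp.2.2) (hAS q hq.1 hq.2.2) (hAS r hr.1 hr.2.2) hpq hqr hpr,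
      ← tri_mem_wordPerms hA hp.1 hq.1 hr.1 hpq hqr hpr]
    exact F3 p ⟨hp.1, hp.2.1⟩ q ⟨hq.1, hq.2.1⟩ r ⟨hr.1, hr.2.1⟩ hpq hqr hpr
  have hbs : b ≠ s := by rintro rfl; exact hsB hb
  have hbs₁ : b ≠ s₁ := by rintro rfl; exact hs₁B hb
  have hba : b ≠ a := by rintro rfl; exact haB hb
  have hbZ : b ∈ Z := (hZ b).2 (Or.inl hb)
  have hAZ : ∀ u ∈ A, u ≠ a → u ∉ B → u ∉ Z := by
    intro u hu hua huB huZ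
    rcases (hZ u).1 huZ with h | ⟨i, rfl⟩
    · exact huB h
    · exact (hA hu ha hua).2 (List.prefix_append _ _)
  have hsZ := hAZ s hs has.symm hsB
  have hs₁Z := hAZ s₁ hs₁ has₁.symm hs₁B
  have hzb : z b ≠ b := formPerm_ne_self hZn hZ2 hbZ
  have hzs : z s = s := formPerm_fixes _ hsZ
  have mb : b ∈ {u | u ∈ A ∧ u ∉ W ∧ u ≠ a} := ⟨hBA b hb, hbW, hba⟩
  have ms : s ∈ {u | u ∈ A ∧ u ∉ W ∧ u ≠ a} := ⟨hs, hsW, has.symm⟩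
  have ms₁ : s₁ ∈ {u | u ∈ A ∧ u ∉ W ∧ u ≠ a} := ⟨hs₁, hs₁W, has₁.symm⟩
  have hτb : tri b s s₁ b = s := tri_apply_left hbs hbs₁
  -- The only point moved by both `z` and `(b s s₁)` is `b`. The orbit of `b` under `z` then adds
  -- the words of `W` and the children of `a`.
  have c2 : tri b (z b) s ∈ wordPerms S H := by
    have hτ := F4 b mb s ms s₁ ms₁ hbs h1 hbs₁
    have := mul_mem (mul_mem (mul_mem hz hτ) (inv_mem hz)) (inv_mem hτ)
    rwa [commutator_eq_tri (b := b) ?_ hzb (by rw [hτb]; exact hbs.symm), hτb] at this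
    intro u hzu hτu
    by_contra hub
    have huZ : u ∈ Z := by
      by_contra h
      exact hzu (formPerm_fixes _ h)
    exact hτu (tri_apply_of_ne hub (by rintro rfl; exact hsZ huZ) (by rintro rfl; exact hs₁Z huZ))
  have hzbs : z b ≠ s := fun h => hbs (z.injective (h.trans hzs.symm))
  rw [tri_rotate hzb.symm hzbs hbs, tri_rotate hzbs hbs.symm hzb] at c2
  have F5 := (F4.insert_of_mem ms mb hbs.symm c2).orbit hz (b := b) (c := s) (Or.inr mb)
    (Or.inl rfl) hzb (Or.inr ms) hzs
  have F6 : Full (wordPerms S H) ({u | u ∈ A ∧ u ≠ a} ∪ {u | ∃ i, u = a ++ [i]}) := by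
    refine F5.subset ?_
    have hZm : ∀ u ∈ Z, ∃ j : ℕ, (z ^ j) b = u := fun u hu => exists_formPerm_pow_eq hZn hbZ hu
    rintro u (⟨hu, hua⟩ | hu)
    · by_cases huW : u ∈ W
      · exact Or.inr (hZm u ((hZ u).2 (Or.inl (hWB u huW))))
      · exact Or.inl (Or.inr ⟨hu, huW, hua⟩)
    · exact Or.inr (hZm u ((hZ u).2 (Or.inr hu)))
  constructor
  · have F7 : Full (wordPerms A H) {u | u ∈ A ∧ u ≠ a} := by
      intro p hp q hq r hr hpq hqr hpr
      rw [tri_mem_wordPerms hA hp.1 hq.1 hr.1 hpq hqr hpr,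
        ← tri_mem_wordPerms hS (hAS p hp.1 hp.2) (hAS q hq.1 hq.2) (hAS r hr.1 hr.2) hpq hqr hpr]
      exact F6 p (Or.inl hp) q (Or.inl hq) r (Or.inl hr) hpq hqr hpr
    -- `F3` lacks only `W` and `F7` lacks only `a`; they share `s` and `s₁`.
    refine (F3.union F7 (s := s) (t := s₁) ⟨hs, hsW⟩ ⟨hs, has.symm⟩ ⟨hs₁, hs₁W⟩ ⟨hs₁, has₁.symm⟩
      h1).subset fun u hu => ?_
    by_cases hua : u = a
    · exact Or.inl ⟨hu, by rwa [hua]⟩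
    · exact Or.inr ⟨hu, hua⟩
  · intro p hp q hq i hap hpq haq
    have h4 : ∀ p ∈ A, a ≠ p → a ++ [i] ≠ p := by
      rintro p hp hap rfl
      exact (hA ha hp hap).1 (List.prefix_append _ _)
    rw [← tri_mem_wordPerms hS (haS i) (hAS p hp hap.symm) (hAS q hq haq.symm) (h4 p hp hap) hpq
      (h4 q hq haq)]
    exact F6 _ (Or.inr ⟨i, rfl⟩) p (Or.inl ⟨hp, hap.symm⟩) q (Or.inl ⟨hq, haq.symm⟩) (h4 p hp hap)
      hpq (h4 q hq haq)

end Cycles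

/-! ### Products of disjoint cycles of coprime lengths and their transport by `g` -/

section CycleProducts

variable {n : ℕ}

theorem isOfFinOrder_of_isBasisPair {h : Perm (Cantor n)} {A : Finset (Word n)} {σ : Perm A}
    (H : IsBasisPair h A A σ) : IsOfFinOrder h := by
  obtain ⟨hA, -, hσ⟩ := H
  refine isOfFinOrder_iff_pow_eq_one.2 ⟨orderOf σ, orderOf_pos σ, ?_⟩
  have key : ∀ (k : ℕ) (u : A) (w : Cantor n), (h ^ k) (app u.1 w) = app ((σ ^ k) u).1 w := by
    intro k
    induction k with
    | zero => simp
    | succ k ih =>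
      intro u w
      rw [pow_succ, pow_succ, Perm.mul_apply, Perm.mul_apply, hσ, ih]
  ext1 x
  obtain ⟨u, ⟨hu, w, rfl⟩, -⟩ := hA x
  rw [key _ ⟨u, hu⟩, pow_orderOf_eq_one]
  rfl

theorem pairwise_commute_formPerm {α : Type*} [DecidableEq α] {Ls : List (List α)}
    (hL : ∀ L ∈ Ls, L.Nodup ∧ 2 ≤ L.length) (hd : Ls.Pairwise List.Disjoint) :
    (Ls.map List.formPerm).Pairwise Perm.Disjoint := by
  rw [List.pairwise_map]
  refine hd.imp_of_mem fun {L L'} h h' hLL => ?_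
  exact (List.formPerm_disjoint_iff (hL L h).1 (hL L' h').1 (hL L h).2 (hL L' h').2).2 hLL

theorem orderOf_formPerm_dvd {α : Type*} [DecidableEq α] {L : List α} (hL : L.Nodup) :
    orderOf L.formPerm ∣ L.length :=
  orderOf_dvd_of_pow_eq_one (List.formPerm_pow_length_eq_one_of_nodup L hL)

theorem formPerm_mem_of_prod_mem {α : Type*} [DecidableEq α] {K : Subgroup (Perm α)}
    {Ls : List (List α)} (hL : ∀ L ∈ Ls, L.Nodup ∧ 2 ≤ L.length)
    (hd : Ls.Pairwise List.Disjoint)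
    (hc : Ls.Pairwise fun L L' => L.length.Coprime L'.length)
    (h : (Ls.map List.formPerm).prod ∈ K) : ∀ L ∈ Ls, L.formPerm ∈ K := by
  have := mem_of_list_prod_mem ((pairwise_commute_formPerm hL hd).imp fun h => h.commute) ?_ h
  · exact fun L hLs => this _ (List.mem_map_of_mem hLs)
  · rw [List.pairwise_map]
    refine hc.imp_of_mem fun {L L'} h h' hLL => ?_
    exact Nat.Coprime.coprime_dvd_left (orderOf_formPerm_dvd (hL L h).1)
      (Nat.Coprime.coprime_dvd_right (orderOf_formPerm_dvd (hL L' h').1) hLL)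

theorem prod_formPerm_fixes {α : Type*} [DecidableEq α] {S : Set α} {Ls : List (List α)}
    (hLS : ∀ L ∈ Ls, ∀ u ∈ L, u ∈ S) : ∀ u ∉ S, (Ls.map List.formPerm).prod u = u := by
  induction Ls with
  | nil => simp
  | cons L Ls ih =>
    intro u hu
    rw [List.map_cons, List.prod_cons, Perm.mul_apply,
      ih (fun L hL => hLS L (List.mem_cons_of_mem _ hL)) u hu]
    exact formPerm_fixes u fun h => hu (hLS L (by simp) u h)

/-- The antichain is enlarged to a basis whose additional words are fixed. On that basis the cycle
factors are exactly the cycles of the given lists. -/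
theorem isCoprimeCycleProduct_of_lists {S : Set (Word n)} (hf : S.Finite)
    (hS : S.Pairwise Perp)
    {Ls : List (List (Word n))} (hLS : ∀ L ∈ Ls, ∀ u ∈ L, u ∈ S)
    (hL : ∀ L ∈ Ls, L.Nodup ∧ 2 ≤ L.length)
    (hd : Ls.Pairwise List.Disjoint) (hc : Ls.Pairwise fun L L' => L.length.Coprime L'.length)
    {h : Perm (Cantor n)} (hh : Lifts S (Ls.map List.formPerm).prod h) :
    IsCoprimeCycleProduct h ∧ IsOfFinOrder h := by
  obtain ⟨B, hB, hSB, hBP⟩ := exists_isBasis_superset hf hS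
  have hfix := prod_formPerm_fixes hLS
  rw [lifts_subset_iff hSB hBP hfix, lifts_iff] at hh
  have hLB : ∀ L ∈ Ls, ∀ u ∈ L, u ∈ B := fun L hL u hu => hSB (hLS L hL u hu)
  lift Ls to List (List B) using hLB
  have hval : Function.Injective (Subtype.val : B → Word n) := Subtype.val_injective
  have hσ : ∀ u : B, ((Ls.map List.formPerm).prod u : Word n) =
      (((Ls.map (List.map Subtype.val)).map List.formPerm).prod : Perm (Word n)) u := by
    clear hLS hL hd hc hfix hh
    induction Ls with
    | nil => simp
    | cons L Ls ih =>
      intro u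
      simp only [List.map_cons, List.prod_cons, Perm.mul_apply]
      rw [← ih, formPerm_map_apply hval]
  have hL' : ∀ L ∈ Ls, L.Nodup ∧ 2 ≤ L.length := by
    intro L h
    have := hL _ (List.mem_map_of_mem h)
    rwa [List.nodup_map_iff hval, List.length_map] at this
  have hd' : Ls.Pairwise List.Disjoint := by
    rw [List.pairwise_map] at hd
    refine hd.imp fun {L L'} h u hu hu' => ?_
    exact h (List.mem_map_of_mem hu) (List.mem_map_of_mem hu')
  have hc' : Ls.Pairwise fun L L' => L.length.Coprime L'.length := by
    rw [List.pairwise_map] at hc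
    refine hc.imp fun {L L'} h => ?_
    simpa using h
  have hpair : IsBasisPair h B B (Ls.map List.formPerm).prod := by
    refine ⟨hB, hB, fun u w => ?_⟩
    rw [hσ]
    exact hh.1 u u.2 w
  refine ⟨⟨B, _, hpair, ?_⟩, isOfFinOrder_of_isBasisPair hpair⟩
  have hdis := pairwise_commute_formPerm hL' hd'
  have hcyc : ∀ f ∈ Ls.map List.formPerm, f.IsCycle := by
    intro f hf
    obtain ⟨L, hLs, rfl⟩ := List.mem_map.1 hf
    exact List.isCycle_formPerm (hL' L hLs).1 (hL' L hLs).2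
  have hnd : (Ls.map List.formPerm).Nodup :=
    Perm.nodup_of_pairwise_disjoint_cycles hcyc hdis
  have hfac : Perm.cycleFactorsFinset (Ls.map List.formPerm).prod =
      (Ls.map List.formPerm).toFinset :=
    (Perm.cycleFactorsFinset_eq_list_toFinset hnd).2 ⟨hcyc, hdis, rfl⟩
  have hco : (Ls.map List.formPerm).Pairwise fun c d => (orderOf c).Coprime (orderOf d) := by
    rw [List.pairwise_map]
    refine hc'.imp_of_mem fun {L L'} h h' hLL => ?_
    exact Nat.Coprime.coprime_dvd_left (orderOf_formPerm_dvd (hL' L h).1)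
      (Nat.Coprime.coprime_dvd_right (orderOf_formPerm_dvd (hL' L' h').1) hLL)
  intro c hc d hd hcd
  rw [hfac, List.mem_toFinset] at hc hd
  have : Std.Symm fun c d : Perm B => (orderOf c).Coprime (orderOf d) := ⟨fun _ _ h => h.symm⟩
  exact hco.forall hc hd hcd

/-- Used with `D` the words below `d`, which `h` preserves whereas `g` does not; this distinguishes
`h` from `g`. -/
theorem prod_formPerm_mem_of_stable {α : Type*} [DecidableEq α] {D : Set α} {Ls : List (List α)}
    (h : ∀ L ∈ Ls, (∀ u ∈ L, u ∈ D) ∨ ∀ u ∈ L, u ∉ D) :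
    ∀ u ∈ D, (Ls.map List.formPerm).prod u ∈ D := by
  induction Ls with
  | nil => simp
  | cons L Ls ih =>
    intro u hu
    rw [List.map_cons, List.prod_cons, Perm.mul_apply]
    have hv := ih (fun L hL => h L (List.mem_cons_of_mem _ hL)) u hu
    set v := (Ls.map List.formPerm).prod u
    by_cases hvL : v ∈ L
    · rcases h L (by simp) with h' | h'
      · exact h' _ (List.formPerm_apply_mem_of_mem hvL)
      · exact absurd hv (h' v hvL)
    · rwa [formPerm_fixes v hvL]

/-- Indexing by the tails makes a change of the prefix `d` an instance of `Moves.conj`. -/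
theorem lifts_map_iff {d : Word n} {L : List (Word n)} {k : Perm (Cantor n)} :
    Lifts {u | u ∈ L.map (d ++ ·)} (L.map (d ++ ·)).formPerm k ↔
      Moves (fun x : {x // x ∈ L} => d ++ x.1) (fun x => d ++ L.formPerm x.1) k := by
  rw [lifts_iff]
  simp only [Moves, Set.mem_ofPred_eq, List.mem_map, forall_exists_index, and_imp,
    forall_apply_eq_imp_iff₂, Subtype.forall]
  have := fun a : Word n => formPerm_map_apply (List.append_right_injective d) L a
  simp only [this]

/-- Conjugation by `g` copies a cycle below `d` to the same cycle below `d'`. -/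
theorem formPerm_map_mem_wordPerms {H : Subgroup (Perm (Cantor n))} {g : Perm (Cantor n)}
    (hg : g ∈ H) {d d' : Word n} (hd : Sends g d d') {L : List (Word n)} {S S' : Set (Word n)}
    (hS : S.Pairwise Perp) (hS' : S'.Pairwise Perp) (hL : ∀ x ∈ L, d ++ x ∈ S)
    (hL' : ∀ x ∈ L, d' ++ x ∈ S') (h : (L.map (d ++ ·)).formPerm ∈ wordPerms S H) :
    (L.map (d' ++ ·)).formPerm ∈ wordPerms S' H := by
  have hsub : ∀ {d : Word n} {S : Set (Word n)}, (∀ x ∈ L, d ++ x ∈ S) →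
      {u | u ∈ L.map (d ++ ·)} ⊆ S := by
    rintro d S h u hu
    obtain ⟨x, hx, rfl⟩ := List.mem_map.1 hu
    exact h x hx
  rw [← wordPerms_subset_iff (hsub hL) hS formPerm_fixes] at h
  rw [← wordPerms_subset_iff (hsub hL') hS' formPerm_fixes]
  obtain ⟨-, k, hk, hl⟩ := h
  refine ⟨formPerm_fixes, _, H.mul_mem (H.mul_mem hg hk) (H.inv_mem hg), ?_⟩
  rw [lifts_map_iff] at hl ⊢
  exact hl.conj (fun x => hd.append _) (fun x => hd.append _)

end CycleProducts

/-! ### Construction of the partner `h` -/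

section Construction

variable {n : ℕ}

theorem pairwise_perp_replace {A : Set (Word n)} (hA : A.Pairwise Perp) {a : Word n}
    (ha : a ∈ A) : ({u | u ∈ A ∧ u ≠ a} ∪ {u | ∃ i : Fin n, u = a ++ [i]}).Pairwise Perp := by
  rintro u (⟨hu, hua⟩ | ⟨i, rfl⟩) v (⟨hv, hva⟩ | ⟨j, rfl⟩) huv
  · exact hA hu hv huv
  · exact (hA hu ha hua).mono (List.prefix_refl _) (List.prefix_append _ _)
  · exact (hA ha hv hva.symm).mono (List.prefix_append _ _) (List.prefix_refl _)
  · exact perp_append_singleton (by rintro rfl; exact huv rfl)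

theorem card_level (n k : ℕ) : (level n k).card = n ^ k := by
  rw [level, Finset.card_image_of_injective _ List.ofFn_injective, Finset.card_univ,
    Fintype.card_fun, Fintype.card_fin, Fintype.card_fin]

theorem exists_distinct_words (hn : 2 ≤ n) {M p q : ℕ} (h : p + q + 7 ≤ M) :
    ∃ (s s₁ s₂ a t₁ t₂ b : Word n) (W B : List (Word n)),
      (s :: s₁ :: s₂ :: a :: t₁ :: t₂ :: (W ++ b :: B)).Nodup ∧
      (∀ x ∈ s :: s₁ :: s₂ :: a :: t₁ :: t₂ :: (W ++ b :: B), x.length = M) ∧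
      W.length = p ∧ B.length = q := by
  set l := (level n M).toList with hl
  have hlen : p + q + 7 ≤ l.length := by
    rw [hl, Finset.length_toList, card_level]
    exact h.trans (Nat.lt_pow_self (by omega)).le
  have hnd : l.Nodup := Finset.nodup_toList _
  have hmem : ∀ x ∈ l, x.length = M := fun x hx => mem_level.1 (Finset.mem_toList.1 hx)
  clear_value l
  match l with
  | s :: s₁ :: s₂ :: a :: t₁ :: t₂ :: b :: L =>
    simp only [List.length_cons] at hlen
    refine ⟨s, s₁, s₂, a, t₁, t₂, b, L.take p, (L.drop p).take q, ?_, ?_, by simp; omega,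
      by simp; omega⟩
    · refine (List.Perm.nodup_iff ?_).1 (hnd.sublist (l₁ := s :: s₁ :: s₂ :: a :: t₁ :: t₂ :: b ::
        (L.take p ++ (L.drop p).take q)) ?_)
      · simp only [List.perm_cons]
        exact List.perm_middle.symm
      · simp only [List.cons_sublist_cons]
        conv_rhs => rw [← List.take_append_drop p L]
        exact List.Sublist.append_left (List.take_sublist _ _) _
    · intro x hx
      apply hmem
      simp only [List.mem_cons, List.mem_append] at hx ⊢
      rcases hx with h | h | h | h | h | h | h | h | h
      all_goals first
        | simp [h] | simp [List.mem_of_mem_take h] | simp [List.mem_of_mem_drop (List.mem_of_mem_take h)]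
  | [] | [_] | [_, _] | [_, _, _] | [_, _, _, _] | [_, _, _, _, _] | [_, _, _, _, _, _] =>
    simp at hlen

/-- The main construction: every nontrivial `g ∈ V n` generates, together with a suitable product
of disjoint cycles of coprime orders, a group that contains the derived subgroup. The cycle of
length two is included if and only if `c` is true. -/
theorem exists_coprimeCycleProduct (hn : 2 ≤ n) {g : Perm (Cantor n)} (hgV : g ∈ V n)
    (hg1 : g ≠ 1) (c : Bool) : ∃ h ∈ V n, h ≠ g ∧ IsCoprimeCycleProduct h ∧ IsOfFinOrder h ∧
      derivedV n ≤ Subgroup.closure {g, h} ∧ (c = false → h ∈ derivedV n) ∧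
      (c = true → V n ≤ Subgroup.closure {g, h}) := by
  have w0 : Cantor n := fun _ => ⟨0, by omega⟩
  obtain ⟨d, d', e, e', hd, he, hdd, hde, hde'⟩ := exists_sends_perp hn hgV hg1
  -- `κ` is the length of the cycle `z`: odd, prime to three, and large enough for the `n` children
  -- of `a`, the at most 29 words of `W`, and `b`.
  have hκ : n + 60 ≤ 5 ^ (n + 3) := by
    have := Nat.lt_pow_self (n := n) (a := 5) (by norm_num)
    rw [pow_add]
    omega
  set κ := 5 ^ (n + 3) with hκdef
  -- There are more than `M` words of length `M`, enough for the `κ - n + 6` words chosen below. The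
  -- summand `d.length` makes `N` exceed the length of `d`.
  set M := d.length + κ + 7 with hM
  set N := d'.length + M with hN
  set A : Finset (Word n) := (level n N).filter fun u => ¬ d <+: u with hAdef
  have memA : ∀ u, u ∈ A ↔ u.length = N ∧ ¬ d <+: u := fun u => by
    rw [hAdef, Finset.mem_filter, mem_level]
  have hA : (A : Set (Word n)).Pairwise Perp := fun u hu v hv huv =>
    perp_of_length_eq (((memA u).1 hu).1.trans ((memA v).1 hv).1.symm) huv
  -- Leaving `s₁`, `s₂` and `e₀` further words `W` out of `A` makes the length of the cycle `y`
  -- congruent to 1 modulo 30, hence prime to 2, 3 and 5.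
  set e₀ := (A.card - 3) % 30 with he₀
  have he₀' : e₀ < 30 := Nat.mod_lt _ (by norm_num)
  obtain ⟨s, s₁, s₂, a, t₁, t₂, b, W, B', hnd, hlen, hW, hB'⟩ :=
    exists_distinct_words hn (M := M) (p := e₀) (q := κ - n - e₀ - 1) (by omega)
  set B := W ++ b :: B' with hB
  have hBlen : B.length = κ - n := by
    rw [hB, List.length_append, List.length_cons, hW, hB']
    omega
  set l := s :: s₁ :: s₂ :: a :: t₁ :: t₂ :: B with hl
  have hdA : ∀ x ∈ l, d' ++ x ∈ A := by
    intro x hx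
    rw [memA, List.length_append, hlen x hx]
    exact ⟨rfl, (hdd.mono (List.prefix_refl _) (List.prefix_append _ _)).1⟩
  have hinj : ∀ d : Word n, Function.Injective (d ++ ·) := List.append_right_injective
  have hAcard : 33 ≤ A.card := by
    have h1 : (l.map (d' ++ ·)).toFinset ⊆ A := by
      intro u hu
      obtain ⟨x, hx, rfl⟩ := List.mem_map.1 (List.mem_toFinset.1 hu)
      exact hdA x hx
    have h2 := Finset.card_le_card h1
    rw [List.toFinset_card_of_nodup (hnd.map (hinj d')), List.length_map, hl] at h2
    simp only [List.length_cons, hBlen] at h2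
    omega
  have hnd' := hnd
  simp only [hl, List.nodup_cons, List.mem_cons, not_or] at hnd'
  obtain ⟨⟨ss₁, ss₂, sa, st₁, st₂, sB⟩, ⟨s₁s₂, s₁a, s₁t₁, s₁t₂, s₁B⟩, ⟨s₂a, s₂t₁, s₂t₂, s₂B⟩,
    ⟨at₁, at₂, aB⟩, ⟨t₁t₂, t₁B⟩, t₂B, nB⟩ := hnd'
  have hlenB : ∀ x ∈ B, x.length = M := fun x hx => hlen x (by simp [hl, hx])
  have hchild : ∀ x : Word n, x.length = M → ∀ i, x ≠ a ++ [i] := by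
    intro x hx i h
    have ha := hlen a (by simp [hl])
    rw [h, List.length_append, List.length_singleton] at hx
    omega
  set Z := List.ofFn (fun i : Fin n => a ++ [i]) ++ B with hZ
  have memZ : ∀ u, u ∈ Z ↔ u ∈ B ∨ ∃ i, u = a ++ [i] := by
    intro u
    rw [hZ, List.mem_append, List.mem_ofFn, or_comm]
    simp only [eq_comm]
  have lenZ : Z.length = κ := by
    rw [hZ, List.length_append, List.length_ofFn, hBlen]
    omega
  have ndZ : Z.Nodup := by
    rw [hZ, List.nodup_append]
    refine ⟨List.nodup_ofFn.2 fun i j h => by simpa using h, nB, ?_⟩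
    intro x hx y hy hxy
    obtain ⟨i, rfl⟩ := List.mem_ofFn.1 hx
    exact hchild y (hlenB y hy) i hxy.symm
  set E : Finset (Word n) := ((s₁ :: s₂ :: W).map (d' ++ ·)).toFinset with hE
  have hWB : ∀ x ∈ W, x ∈ B := fun x hx => by simp [hB, hx]
  have ndE : (s₁ :: s₂ :: W).Nodup := by
    rw [List.nodup_cons, List.nodup_cons, List.mem_cons, not_or]
    exact ⟨⟨s₁s₂, fun h => s₁B (hWB _ h)⟩, fun h => s₂B (hWB _ h),
      nB.sublist (List.sublist_append_left _ _)⟩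
  have hEA : E ⊆ A := by
    intro u hu
    obtain ⟨x, hx, rfl⟩ := List.mem_map.1 (List.mem_toFinset.1 hu)
    apply hdA
    simp only [List.mem_cons] at hx
    rcases hx with rfl | rfl | hx
    · simp [hl]
    · simp [hl]
    · simp [hl, hWB _ hx]
  have cardE : E.card = e₀ + 2 := by
    rw [hE, List.toFinset_card_of_nodup (ndE.map (hinj d')), List.length_map]
    simp [hW]
  set Y := (A \ E).toList with hY
  have lenY : Y.length = 30 * ((A.card - 3) / 30) + 1 := by
    rw [hY, Finset.length_toList, Finset.card_sdiff_of_subset hEA, cardE]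
    have := Nat.div_add_mod (A.card - 3) 30
    omega
  have memY : ∀ u, u ∈ Y ↔ u ∈ (A : Set (Word n)) ∧ u ≠ d' ++ s₁ ∧ u ≠ d' ++ s₂ ∧
      u ∉ {u | u ∈ W.map (d' ++ ·)} := by
    intro u
    rw [hY, Finset.mem_toList, Finset.mem_sdiff, hE, List.mem_toFinset, List.map_cons,
      List.map_cons, List.mem_cons, List.mem_cons, not_or, not_or]
    rfl
  -- The tails of the words that `h` permutes below `d`: the chosen words, with `a` replaced by its
  -- children.
  set R : Set (Word n) := {u | u ∈ {u | u ∈ l} ∧ u ≠ a} ∪ {u | ∃ i : Fin n, u = a ++ [i]} with hRdef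
  have hl' : {u | u ∈ l}.Pairwise Perp := fun u hu v hv huv =>
    perp_of_length_eq ((hlen u hu).trans (hlen v hv).symm) huv
  have hR : R.Pairwise Perp := pairwise_perp_replace hl' (a := a) (by simp [hl])
  have hRf : R.Finite := by
    refine ((List.finite_toSet l).subset fun u hu => hu.1).union ?_
    refine (Set.finite_range fun i : Fin n => a ++ [i]).subset ?_
    rintro u ⟨i, rfl⟩
    exact ⟨i, rfl⟩
  have hXR : ∀ x ∈ [s, s₁, s₂], x ∈ R := by
    intro x hx
    simp only [List.mem_cons, List.not_mem_nil, or_false] at hx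
    left
    rcases hx with rfl | rfl | rfl <;> exact ⟨by simp [hl], by assumption⟩
  have hTR : ∀ x ∈ [t₁, t₂], x ∈ R := by
    intro x hx
    simp only [List.mem_cons, List.not_mem_nil, or_false] at hx
    left
    rcases hx with rfl | rfl <;> exact ⟨by simp [hl], Ne.symm (by assumption)⟩
  have hZR : ∀ x ∈ Z, x ∈ R := by
    intro x hx
    rcases (memZ x).1 hx with h | h
    · exact Or.inl ⟨by simp [hl, h], by rintro rfl; exact aB h⟩
    · exact Or.inr h
  set S : Set (Word n) := (A : Set (Word n)) ∪ (d ++ ·) '' R with hSdef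
  have hSf : S.Finite := A.finite_toSet.union (hRf.image _)
  have hdPerp : ∀ u ∈ A, ∀ x, Perp u (d ++ x) := by
    intro u hu x
    refine Perp.mono (u := u) (v := d) ⟨fun h => ?_, ((memA u).1 hu).2⟩ (List.prefix_refl _)
      (List.prefix_append _ _)
    have h1 := h.length_le
    rw [((memA u).1 hu).1] at h1
    omega
  have hS : S.Pairwise Perp := by
    rintro u (hu | ⟨x, hx, rfl⟩) v (hv | ⟨y, hy, rfl⟩) huv
    · exact hA hu hv huv
    · exact hdPerp u hu y
    · exact (hdPerp v hv x).symm
    · exact perp_append_left.2 (hR hx hy (by rintro rfl; exact huv rfl))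
  have hAS : (A : Set (Word n)) ⊆ S := Set.subset_union_left
  have hRS : ∀ L : List (Word n), (∀ x ∈ L, x ∈ R) → ∀ u ∈ L.map (d ++ ·), u ∈ S := by
    intro L hL u hu
    obtain ⟨x, hx, rfl⟩ := List.mem_map.1 hu
    exact Or.inr ⟨x, hL x hx, rfl⟩
  set L₄ : List (List (Word n)) :=
    [Y, [s, s₁, s₂].map (d ++ ·), Z.map (d ++ ·), [t₁, t₂].map (d ++ ·)] with hL₄
  have hLS₄ : ∀ L ∈ L₄, ∀ u ∈ L, u ∈ S := by
    intro L hL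
    simp only [hL₄, List.mem_cons, List.not_mem_nil, or_false] at hL
    rcases hL with rfl | rfl | rfl | rfl
    · exact fun u hu => hAS ((memY u).1 hu).1
    · exact hRS _ hXR
    · exact hRS _ hZR
    · exact hRS _ hTR
  have hnl₄ : ∀ L ∈ L₄, L.Nodup ∧ 2 ≤ L.length := by
    intro L hL
    simp only [hL₄, List.mem_cons, List.not_mem_nil, or_false] at hL
    rcases hL with rfl | rfl | rfl | rfl
    · exact ⟨Finset.nodup_toList _, by rw [lenY]; omega⟩
    · exact ⟨List.Nodup.map (hinj d) (by simp [ss₁, ss₂, s₁s₂]), by simp⟩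
    · exact ⟨ndZ.map (hinj d), by rw [List.length_map, lenZ]; omega⟩
    · exact ⟨List.Nodup.map (hinj d) (by simp [t₁t₂]), by simp⟩
  have hYd : ∀ L : List (Word n), Y.Disjoint (L.map (d ++ ·)) := by
    intro L u hu hu'
    obtain ⟨x, -, rfl⟩ := List.mem_map.1 hu'
    exact (hdPerp _ ((memY _).1 hu).1 x).ne rfl
  have notMemZ : ∀ x ∈ l, x ∉ B → x ∉ Z := by
    intro x hx hxB hxZ
    rcases (memZ x).1 hxZ with h | ⟨i, h⟩
    · exact hxB h
    · exact hchild x (hlen x hx) i h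
  have hd₄ : L₄.Pairwise List.Disjoint := by
    have h1 : [s, s₁, s₂].Disjoint Z := by
      intro x hx
      simp only [List.mem_cons, List.not_mem_nil, or_false] at hx
      rcases hx with rfl | rfl | rfl <;> exact notMemZ _ (by simp [hl]) (by assumption)
    have h2 : Z.Disjoint [t₁, t₂] := by
      intro x hxZ hx
      simp only [List.mem_cons, List.not_mem_nil, or_false] at hx
      rcases hx with rfl | rfl <;> exact notMemZ _ (by simp [hl]) (by assumption) hxZ
    have h3 : [s, s₁, s₂].Disjoint [t₁, t₂] := by
      simp [List.disjoint_left, st₁, st₂, s₁t₁, s₁t₂, s₂t₁, s₂t₂]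
    simp only [hL₄, List.pairwise_cons, List.mem_cons, List.not_mem_nil, or_false,
      forall_eq_or_imp, forall_eq, false_imp_iff, implies_true, List.Pairwise.nil, and_true]
    exact ⟨⟨hYd _, hYd _, hYd _⟩, ⟨List.disjoint_map (hinj d) h1, List.disjoint_map (hinj d) h3⟩,
      List.disjoint_map (hinj d) h2⟩
  have hc₄ : L₄.Pairwise fun L L' => L.length.Coprime L'.length := by
    simp only [hL₄, List.pairwise_cons, List.mem_cons, List.not_mem_nil, or_false,
      forall_eq_or_imp, forall_eq, false_imp_iff, implies_true, List.Pairwise.nil, and_true,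
      List.length_map, lenZ, lenY, List.length_cons, List.length_nil]
    have hq : ∀ p, p ∣ 30 → (30 * ((A.card - 3) / 30) + 1).Coprime p := by
      rintro p ⟨r, hr⟩
      generalize (A.card - 3) / 30 = t
      rw [hr, mul_assoc, Nat.coprime_mul_left_add_left]
      exact Nat.coprime_one_left p
    refine ⟨⟨hq 3 (by norm_num), Nat.Coprime.pow_right _ (hq 5 (by norm_num)),
      hq 2 (by norm_num)⟩, ⟨Nat.Coprime.pow_right _ (by norm_num), by norm_num⟩,
      Nat.Coprime.pow_left _ (by norm_num)⟩
  -- The first three cycles are always present; `c` decides about the transposition, the only cycle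
  -- of even length.
  obtain ⟨Ls, hLsub, hL₃, hLt⟩ : ∃ Ls : List (List (Word n)), Ls.Sublist L₄ ∧
      (∀ L ∈ L₄.take 3, L ∈ Ls) ∧ (if c = true then [t₁, t₂].map (d ++ ·) ∈ Ls else
        ∀ L ∈ Ls, Odd L.length) := by
    cases c
    · refine ⟨L₄.take 3, List.take_sublist _ _, fun L hL => hL, ?_⟩
      simp only [hL₄, List.take_succ_cons, List.take_zero, List.mem_cons, List.not_mem_nil,
        or_false, forall_eq_or_imp, forall_eq, List.length_map, lenZ, lenY, List.length_cons,
        List.length_nil, reduceCtorEq, if_false]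
      exact ⟨⟨15 * ((A.card - 3) / 30), by ring⟩, by decide, Odd.pow (by decide)⟩
    · exact ⟨L₄, List.Sublist.refl _, fun L hL => List.mem_of_mem_take hL, by simp [hL₄]⟩
  have hLS : ∀ L ∈ Ls, ∀ u ∈ L, u ∈ S := fun L hL => hLS₄ L (hLsub.subset hL)
  have hnl : ∀ L ∈ Ls, L.Nodup ∧ 2 ≤ L.length := fun L hL => hnl₄ L (hLsub.subset hL)
  have hdis := hd₄.sublist hLsub
  have hcop := hc₄.sublist hLsub
  have hfix := prod_formPerm_fixes hLS
  obtain ⟨h, hh⟩ := exists_lifts hS hfix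
  obtain ⟨hprod, hfin⟩ := isCoprimeCycleProduct_of_lists hSf hS hLS hnl hdis hcop hh
  set H := Subgroup.closure {g, h} with hH
  have hgH : g ∈ H := Subgroup.subset_closure (by simp)
  have hhH : h ∈ H := Subgroup.subset_closure (by simp)
  have hmem := formPerm_mem_of_prod_mem (K := wordPerms S H) hnl hdis hcop ⟨hfix, h, hhH, hh⟩
  have hder : derivedV n ≤ H := by
    have hda : d' ++ a ∈ (A : Set (Word n)) := hdA a (by simp [hl])
    have hy : Y.formPerm ∈ wordPerms (A : Set (Word n)) H :=
      (wordPerms_subset_iff hAS hS fun u hu => formPerm_fixes u fun h => hu ((memY u).1 h).1).2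
        (hmem Y (hL₃ _ (by simp [hL₄])))
    have hx : tri (d' ++ s) (d' ++ s₁) (d' ++ s₂) ∈ wordPerms (A : Set (Word n)) H := by
      refine formPerm_map_mem_wordPerms (L := [s, s₁, s₂]) hgH hd hS hA
        (fun x hx => hRS _ hXR _ (List.mem_map_of_mem hx)) (fun x hx => hdA x ?_)
        (hmem _ (hL₃ _ (by simp [hL₄])))
      simp only [List.mem_cons, List.not_mem_nil, or_false] at hx
      rcases hx with rfl | rfl | rfl <;> simp [hl]
    have hS' := pairwise_perp_replace hA hda
    have hz : (Z.map (d' ++ ·)).formPerm ∈ wordPerms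
        ({u | u ∈ (A : Set (Word n)) ∧ u ≠ d' ++ a} ∪ {u | ∃ i : Fin n, u = d' ++ a ++ [i]}) H := by
      refine formPerm_map_mem_wordPerms hgH hd hS hS'
        (fun x hx => hRS _ hZR _ (List.mem_map_of_mem hx)) (fun x hx => ?_)
        (hmem _ (hL₃ _ (by simp [hL₄])))
      rcases (memZ x).1 hx with hx | ⟨i, rfl⟩
      · refine Or.inl ⟨hdA x (by simp [hl, hx]), fun h => ?_⟩
        rw [hinj d' h] at hx
        exact aB hx
      · exact Or.inr ⟨i, (List.append_assoc _ _ _).symm⟩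
    have hne : ∀ {x y : Word n}, x ≠ y → d' ++ x ≠ d' ++ y := fun h h' => h (hinj d' h')
    have hnm : ∀ {x : Word n}, x ∉ B → d' ++ x ∉ B.map (d' ++ ·) := by
      intro x hx h
      obtain ⟨y, hy, h⟩ := List.mem_map.1 h
      rw [hinj d' h] at hy
      exact hx hy
    have hbW : b ∉ W := by
      intro hb
      rw [hB, List.nodup_append] at nB
      exact nB.2.2 b hb b (by simp) rfl
    obtain ⟨hF, hF'⟩ := full_of_cycles hA hS' (s := d' ++ s) (s₁ := d' ++ s₁) (s₂ := d' ++ s₂)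
      (a := d' ++ a) (W := {u | u ∈ W.map (d' ++ ·)}) (B := B.map (d' ++ ·)) (b := d' ++ b)
      (Z := Z.map (d' ++ ·)) (hdA s (by simp [hl])) (hdA s₁ (by simp [hl])) hda
      (hne ss₁) (hne s₁s₂) (hne ss₂) (hne (Ne.symm sa)) (hne (Ne.symm s₁a)) (hne (Ne.symm s₂a))
      (fun u hu => by
        obtain ⟨x, hx, rfl⟩ := List.mem_map.1 hu
        exact hdA x (by simp [hl, hx]))
      (hnm sB) (hnm s₁B) (hnm s₂B) (hnm aB)
      (fun u hu => by
        obtain ⟨x, hx, rfl⟩ := List.mem_map.1 hu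
        exact List.mem_map_of_mem (hWB x hx))
      (List.mem_map_of_mem (by simp [hB]))
      (fun h => by
        obtain ⟨x, hx, h⟩ := List.mem_map.1 h
        rw [hinj d' h] at hx
        exact hbW hx)
      (Finset.nodup_toList _) memY (fun u hu hua => Or.inl ⟨hu, hua⟩) (fun i => Or.inr ⟨i, rfl⟩)
      (ndZ.map (hinj d'))
      (fun u => by
        constructor
        · intro hu
          obtain ⟨x, hx, rfl⟩ := List.mem_map.1 hu
          rcases (memZ x).1 hx with hx | ⟨i, rfl⟩
          · exact Or.inl (List.mem_map_of_mem hx)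
          · exact Or.inr ⟨i, (List.append_assoc _ _ _).symm⟩
        · rintro (hu | ⟨i, rfl⟩)
          · obtain ⟨x, hx, rfl⟩ := List.mem_map.1 hu
            exact List.mem_map_of_mem ((memZ x).2 (Or.inl hx))
          · rw [List.append_assoc]
            exact List.mem_map_of_mem (f := (d' ++ ·)) ((memZ _).2 (Or.inr ⟨i, rfl⟩)))
      (by rw [List.length_map, lenZ]; omega) hy hx hz
    have hchildren := triIn_child_of_full (by omega) hF hda hF'
    refine derivedV_le_of_outside hn hgH hd he hdd hde hde' N ?_
    have hpre : ∀ u : Word n, N ≤ u.length → ¬ d <+: u → ∃ a ∈ A, a <+: u := fun u hu hdu =>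
      ⟨u.take N, (memA _).2 ⟨by simp [hu], fun h => hdu (h.trans (List.take_prefix _ _))⟩,
        List.take_prefix _ _⟩
    intro u v w hu hv hw hdu hdv hdw huv hvw huw
    refine triIn_of_prefix_mem hn hA (fun a ha => ((memA a).1 ha).1) (by omega) ?_ hchildren u v w
      (hpre u hu hdu) (hpre v hv hdv) (hpre w hw hdw) huv hvw huw
    intro p hp q hq r hr hpq hqr hpr
    rw [← tri_mem_wordPerms hA hp hq hr hpq hqr hpr]
    exact hF p hp q hq r hr hpq hqr hpr
  refine ⟨h, hh.mem_V hSf, ?_, hprod, hfin, hder, ?_, ?_⟩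
  · rintro rfl
    have h1 := (lifts_iff.1 hh).1 (d ++ s) (hRS _ hXR _ (by simp))
    have h2 := h1.unique hn (hd.append s)
    -- If `h` were `g`, it would send `d ++ s` to `d' ++ s`, out of the words below `d`, which its
    -- cycles preserve.
    have h3 := prod_formPerm_mem_of_stable (D := {u | d <+: u}) (Ls := Ls) (fun L hL => ?_)
      (d ++ s) (List.prefix_append _ _)
    · rw [h2] at h3
      exact (hdd.mono (List.prefix_refl _) (List.prefix_append _ _)).1 h3
    · have hL' := hLsub.subset hL
      simp only [hL₄, List.mem_cons, List.not_mem_nil, or_false] at hL'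
      have hm : ∀ L : List (Word n), ∀ u ∈ L.map (d ++ ·), d <+: u := by
        intro L u hu
        obtain ⟨x, -, rfl⟩ := List.mem_map.1 hu
        exact List.prefix_append _ _
      rcases hL' with rfl | rfl | rfl | rfl
      · exact Or.inr fun u hu => ((memA u).1 ((memY u).1 hu).1).2
      all_goals exact Or.inl (hm _)
  · rintro rfl
    rw [if_neg (by simp)] at hLt
    refine mem_of_lifts (σ := (Ls.map List.formPerm).prod) (S := S) (Subgroup.list_prod_mem _ ?_) hh
    intro σ hσ
    obtain ⟨L, hL, rfl⟩ := List.mem_map.1 hσ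
    -- Cycles of odd length are products of three-cycles of cones, which lie in the derived
    -- subgroup.
    refine formPerm_mem_of_odd (hnl L hL).1 (hLt L hL) ?_
    intro p hp q hq r hr hpq hqr hpr
    have hp' := hLS L hL p hp
    have hq' := hLS L hL q hq
    have hr' := hLS L hL r hr
    rw [tri_mem_wordPerms hS hp' hq' hr' hpq hqr hpr]
    exact triIn_derivedV (hS hp' hq' hpq) (hS hq' hr' hqr) (hS hp' hr' hpr)
  · rintro rfl
    rw [if_pos rfl] at hLt
    have h1 := hmem _ hLt
    have m1 := hRS _ hTR (d ++ t₁) (by simp)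
    have m2 := hRS _ hTR (d ++ t₂) (by simp)
    rw [List.map_cons, List.map_cons, List.map_nil, List.formPerm_pair,
      swap_mem_wordPerms hS m1 m2] at h1
    have l1 := hlen t₁ (by simp [hl])
    have l2 := hlen t₂ (by simp [hl])
    exact V_le_of_derivedV_le hn hder (by simp; omega) (by simp; omega)
      (hS m1 m2 fun h => t₁t₂ (hinj d h)) h1

end Construction

/-! ### The sign homomorphism for odd `n`, and infinitude -/

section Sign

variable {n : ℕ}

/-- Incomparable words are ordered lexicographically by their first differing letter, whatever
follows. -/
theorem append_lt_append_of_perp {u v : Word n} (hp : Perp u v) (h : u < v) (s t : Word n) :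
    u ++ s < v ++ t := by
  induction u generalizing v with
  | nil => exact absurd List.nil_prefix hp.1
  | cons a u ih =>
    cases v with
    | nil => exact absurd List.nil_prefix hp.2
    | cons b v =>
      rw [List.cons_lt_cons_iff] at h
      rw [List.cons_append, List.cons_append, List.cons_lt_cons_iff]
      rcases h with h | ⟨rfl, h⟩
      · exact Or.inl h
      · refine Or.inr ⟨rfl, ih ?_ h⟩
        simpa [Perp, List.cons_prefix_cons] using hp

theorem append_lt_append_iff_of_perp {u v : Word n} (hp : Perp u v) (s t : Word n) :
    u ++ s < v ++ t ↔ u < v := by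
  refine ⟨fun h => ?_, fun h => append_lt_append_of_perp hp h s t⟩
  by_contra h'
  have := append_lt_append_of_perp hp.symm (lt_of_le_of_ne (not_lt.1 h') hp.ne.symm) t s
  exact lt_asymm h this

theorem append_lt_append_iff (u s t : Word n) : u ++ s < u ++ t ↔ s < t := by
  induction u with
  | nil => rfl
  | cons a u ih => simp [ih]

/-- The parity of the number of pairs that are ordered differently by `f` and `g`. -/
def invParity {ι : Type*} [Fintype ι] (f g : ι → Word n) : ZMod 2 :=
  ∑ i, ∑ j, if f i < f j ∧ g j < g i then 1 else 0

theorem invParity_comp {ι κ : Type*} [Fintype ι] [Fintype κ] (f g : ι → Word n) (e : κ ≃ ι) :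
    invParity (f ∘ e) (g ∘ e) = invParity f g := by
  unfold invParity
  rw [← e.sum_comp]
  refine Finset.sum_congr rfl fun i _ => ?_
  rw [← e.sum_comp]
  rfl

theorem sum_eq_zero_of_symm {ι : Type*} [Fintype ι] (X : ι → ι → ZMod 2)
    (h : ∀ i j, X i j + X j i = 0) (h0 : ∀ i, X i i = 0) : ∑ i, ∑ j, X i j = 0 := by
  classical
  rw [← Fintype.sum_prod_type']
  refine Finset.sum_involution (fun p _ => p.swap) (fun p _ => h p.1 p.2) ?_ (by simp) (by simp)
  rintro ⟨i, j⟩ - hne he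
  obtain rfl : j = i := congrArg Prod.fst he
  exact hne (h0 j)

/-- For each pair of indices, the number of disagreements among the three orders given by `f`, `g`,
`h` is even. -/
theorem invParity_add {ι : Type*} [Fintype ι] {f g h : ι → Word n} (hf : Function.Injective f)
    (hg : Function.Injective g) (hh : Function.Injective h) :
    invParity f h = invParity f g + invParity g h := by
  have key : invParity f h + (invParity f g + invParity g h) = 0 := by
    unfold invParity
    simp only [← Finset.sum_add_distrib]
    apply sum_eq_zero_of_symm
    · intro i j
      by_cases hij : i = j
      · subst hij
        simp
      rcases lt_or_gt_of_ne (hf.ne hij) with h1 | h1 <;>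
      rcases lt_or_gt_of_ne (hg.ne hij) with h2 | h2 <;>
      rcases lt_or_gt_of_ne (hh.ne hij) with h3 | h3 <;>
      simp [h1, h2, h3, h1.not_gt, h2.not_gt, h3.not_gt] <;> decide
    · simp
  rw [← sub_eq_zero, CharTwo.sub_eq_add]
  exact key

/-- Two distinct blocks contribute the product of their sizes, an odd number, times the contribution
of their indices. Within a block the common tails leave no inversion. -/
theorem invParity_sigma {ι : Type*} [Fintype ι] {κ : ι → Type*} [∀ i, Fintype (κ i)]
    (hκ : ∀ i, Odd (Fintype.card (κ i))) {f g : ι → Word n}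
    (hf : Pairwise fun i j => Perp (f i) (f j)) (hg : Pairwise fun i j => Perp (g i) (g j))
    (r : ∀ i, κ i → Word n) :
    invParity (fun p : Σ i, κ i => f p.1 ++ r p.1 p.2) (fun p => g p.1 ++ r p.1 p.2) =
      invParity f g := by
  have hodd : ∀ i, (Fintype.card (κ i) : ZMod 2) = 1 := fun i =>
    (ZMod.natCast_eq_one_iff_odd).2 (hκ i)
  unfold invParity
  rw [Fintype.sum_sigma]
  refine Finset.sum_congr rfl fun i _ => ?_
  have h1 : ∀ a : κ i, (∑ p : Σ i, κ i, if f i ++ r i a < f p.1 ++ r p.1 p.2 ∧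
      g p.1 ++ r p.1 p.2 < g i ++ r i a then (1 : ZMod 2) else 0) =
      ∑ j, if f i < f j ∧ g j < g i then 1 else 0 := by
    intro a
    rw [Fintype.sum_sigma]
    refine Finset.sum_congr rfl fun j _ => ?_
    by_cases hij : i = j
    · subst hij
      simp only [append_lt_append_iff, lt_self_iff_false, and_self, if_false]
      refine Finset.sum_eq_zero fun b _ => if_neg fun h => lt_asymm h.1 h.2
    · simp only [append_lt_append_iff_of_perp (hf hij), append_lt_append_iff_of_perp (hg hij).symm]
      rw [Finset.sum_const, Finset.card_univ, nsmul_eq_mul, hodd, one_mul]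
  rw [Finset.sum_congr rfl fun a _ => h1 a, Finset.sum_const, Finset.card_univ, nsmul_eq_mul, hodd,
    one_mul]

/-- The parity of the number of inversions of the word map `f` on the basis `A`. -/
def basisParity (A : Finset (Word n)) (f : Word n → Word n) : ZMod 2 :=
  invParity (fun u : A => u.1) (fun u : A => f u.1)

theorem pairwise_perp_subtype {A : Finset (Word n)} (hA : (A : Set (Word n)).Pairwise Perp) :
    Pairwise fun u v : A => Perp u.1 v.1 := fun u v huv =>
  hA u.2 v.2 fun h => huv (Subtype.ext h)

theorem pairwise_perp_sends (hn : 2 ≤ n) {A : Finset (Word n)}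
    (hA : (A : Set (Word n)).Pairwise Perp) {g : Perm (Cantor n)} {f : Word n → Word n}
    (hf : ∀ u ∈ A, Sends g u (f u)) : Pairwise fun u v : A => Perp (f u.1) (f v.1) :=
  fun u v huv => (hf u u.2).perp hn (hf v v.2) (pairwise_perp_subtype hA huv)

theorem injective_of_pairwise_perp {ι : Type*} {f : ι → Word n}
    (hf : Pairwise fun i j => Perp (f i) (f j)) : Function.Injective f := fun i j h => by
  by_contra hij
  exact (hf hij).ne h

/-- A word of length `l` is subdivided into its `n ^ (M - l)` descendants of length `M`, an odd
number, so the parity survives. Any two bases can be compared at a common level. -/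
theorem basisParity_eq_level (hn : 2 ≤ n) (ho : Odd n) {A : Finset (Word n)} (hA : IsBasis A)
    {g : Perm (Cantor n)} {f : Word n → Word n} (hf : ∀ u ∈ A, Sends g u (f u)) {M : ℕ}
    (hM : ∀ u ∈ A, u.length ≤ M) {f' : Word n → Word n}
    (hf' : ∀ u ∈ level n M, Sends g u (f' u)) : basisParity A f = basisParity (level n M) f' := by
  have w0 : Cantor n := fun _ => ⟨0, by omega⟩
  have hP := hA.pairwise_perp w0
  let φ : (Σ u : A, level n (M - u.1.length)) → level n M := fun p =>
    ⟨p.1.1 ++ p.2.1, by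
      rw [mem_level, List.length_append, mem_level.1 p.2.2]
      have := hM p.1.1 p.1.2
      omega⟩
  have hφ : Function.Bijective φ := by
    constructor
    · rintro ⟨u, s⟩ ⟨v, t⟩ h
      have h' : u.1 ++ s.1 = v.1 ++ t.1 := congrArg Subtype.val h
      by_cases huv : u = v
      · subst huv
        obtain rfl : s = t := Subtype.ext (List.append_cancel_left h')
        rfl
      · exact absurd h' ((pairwise_perp_subtype hP huv).mono (List.prefix_append _ _)
          (List.prefix_append _ _)).ne
    · rintro ⟨v, hv⟩
      obtain ⟨u, ⟨hu, z, hz⟩, -⟩ := hA (app v w0)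
      rw [mem_level] at hv
      obtain ⟨t, rfl⟩ := prefix_of_app_eq (hv ▸ hM u hu) hz
      refine ⟨⟨⟨u, hu⟩, ⟨t, ?_⟩⟩, rfl⟩
      rw [mem_level]
      rw [List.length_append] at hv
      simp only
      omega
  have h1 := invParity_sigma (κ := fun u : A => level n (M - u.1.length))
    (fun u => by
      rw [Fintype.card_coe, card_level]
      exact ho.pow)
    (pairwise_perp_subtype hP) (pairwise_perp_sends hn hP hf) (fun _ s => s.1)
  rw [basisParity, basisParity, ← h1, ← invParity_comp _ _ (Equiv.ofBijective φ hφ)]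
  congr 1
  funext p
  exact ((hf p.1.1 p.1.2).append p.2.1).unique hn (hf' _ (φ p).2)

/-- `ε` is the parity of `g`, computed in some basis. -/
def HasParity (g : Perm (Cantor n)) (ε : ZMod 2) : Prop :=
  ∃ (A : Finset (Word n)) (f : Word n → Word n), IsBasis A ∧ (∀ u ∈ A, Sends g u (f u)) ∧
    basisParity A f = ε

theorem HasParity.unique (hn : 2 ≤ n) (ho : Odd n) {g : Perm (Cantor n)} (hg : g ∈ V n)
    {ε ε' : ZMod 2} (h : HasParity g ε) (h' : HasParity g ε') : ε = ε' := by
  obtain ⟨A, f, hA, hf, rfl⟩ := h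
  obtain ⟨A', f', hA', hf', rfl⟩ := h'
  obtain ⟨N, hN⟩ := exists_sends_of_mem_V hg 0
  set M := N + A.sup List.length + A'.sup List.length
  have hM : ∀ u : Word n, ∃ v, u ∈ level n M → Sends g u v := by
    intro u
    by_cases hu : u ∈ level n M
    · obtain ⟨v, hv, -⟩ := hN u (by rw [mem_level.1 hu]; omega)
      exact ⟨v, fun _ => hv⟩
    · exact ⟨u, fun h => absurd h hu⟩
  choose F hF using hM
  have l1 : ∀ u ∈ A, u.length ≤ A.sup List.length := fun u hu => Finset.le_sup (f := List.length) hu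
  have l2 : ∀ u ∈ A', u.length ≤ A'.sup List.length :=
    fun u hu => Finset.le_sup (f := List.length) hu
  rw [basisParity_eq_level hn ho hA hf (M := M) (fun u hu => by have := l1 u hu; omega) hF,
    basisParity_eq_level hn ho hA' hf' (M := M) (fun u hu => by have := l2 u hu; omega) hF]

/-- At a deep enough level `h` yields words on which `g` again replaces prefixes. The parity of `g`
is then read off on the image basis. -/
theorem exists_hasParity_mul (hn : 2 ≤ n) {g h : Perm (Cantor n)} (hg : g ∈ V n) (hh : h ∈ V n) :
    ∃ ε ε', HasParity g ε ∧ HasParity h ε' ∧ HasParity (g * h) (ε + ε') := by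
  have w0 : Cantor n := fun _ => ⟨0, by omega⟩
  obtain ⟨N', hN'⟩ := exists_sends_of_mem_V hg 0
  obtain ⟨N, hN⟩ := exists_sends_of_mem_V hh N'
  have hG : ∀ u : Word n, ∃ v, N' ≤ u.length → Sends g u v := by
    intro u
    by_cases hu : N' ≤ u.length
    · obtain ⟨v, hv, -⟩ := hN' u hu
      exact ⟨v, fun _ => hv⟩
    · exact ⟨u, fun h => absurd h hu⟩
  have hF : ∀ u : Word n, ∃ v, u ∈ level n N → Sends h u v ∧ N' ≤ v.length := by
    intro u
    by_cases hu : u ∈ level n N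
    · obtain ⟨v, hv⟩ := hN u (mem_level.1 hu).ge
      exact ⟨v, fun _ => hv⟩
    · exact ⟨u, fun h => absurd h hu⟩
  choose k hk using hG
  choose f hf using hF
  have hA := isBasis_level n N
  have hP := hA.pairwise_perp w0
  have hf1 : ∀ u ∈ level n N, Sends h u (f u) := fun u hu => (hf u hu).1
  have hkf : ∀ u ∈ level n N, Sends (g * h) u (k (f u)) := fun u hu =>
    (hk _ (hf u hu).2).mul (hf1 u hu)
  obtain ⟨hB, hfi⟩ := hA.image hn hf1
  refine ⟨basisParity ((level n N).image f) k, basisParity (level n N) f,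
    ⟨_, k, hB, ?_, rfl⟩, ⟨_, f, hA, hf1, rfl⟩, ⟨_, k ∘ f, hA, hkf, ?_⟩⟩
  · intro u hu
    obtain ⟨v, hv, rfl⟩ := Finset.mem_image.1 hu
    exact hk _ (hf v hv).2
  · have h1 := invParity_add
      (injective_of_pairwise_perp (pairwise_perp_subtype hP))
      (injective_of_pairwise_perp (pairwise_perp_sends hn hP hf1))
      (injective_of_pairwise_perp (pairwise_perp_sends hn hP hkf))
    rw [basisParity, Function.comp_def, h1, add_comm]
    congr 1
    let φ : level n N → (level n N).image f := fun u => ⟨f u.1, Finset.mem_image_of_mem f u.2⟩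
    have hφ : Function.Bijective φ := by
      constructor
      · intro u v h
        exact Subtype.ext (hfi u.2 v.2 (congrArg Subtype.val h))
      · rintro ⟨v, hv⟩
        obtain ⟨u, hu, rfl⟩ := Finset.mem_image.1 hv
        exact ⟨⟨u, hu⟩, rfl⟩
    rw [basisParity, ← invParity_comp _ _ (Equiv.ofBijective φ hφ)]
    rfl

theorem exists_hasParity (hn : 2 ≤ n) {g : Perm (Cantor n)} (hg : g ∈ V n) :
    ∃ ε, HasParity g ε := by
  obtain ⟨ε, -, h, -⟩ := exists_hasParity_mul hn hg hg
  exact ⟨ε, h⟩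

/-- The sign homomorphism of `V n`, for odd `n`. -/
noncomputable def signHom (hn : 2 ≤ n) (ho : Odd n) : V n →* Multiplicative (ZMod 2) :=
  MonoidHom.mk' (fun g => Multiplicative.ofAdd (exists_hasParity hn g.2).choose) fun g h => by
    obtain ⟨ε, ε', h1, h2, h3⟩ := exists_hasParity_mul hn g.2 h.2
    rw [(exists_hasParity hn g.2).choose_spec.unique hn ho g.2 h1,
      (exists_hasParity hn h.2).choose_spec.unique hn ho h.2 h2,
      (exists_hasParity hn (g * h).2).choose_spec.unique hn ho (g * h).2 h3, ofAdd_add]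

theorem signHom_eq (hn : 2 ≤ n) (ho : Odd n) {g : V n} {ε : ZMod 2} (h : HasParity g.1 ε) :
    signHom hn ho g = Multiplicative.ofAdd ε :=
  congrArg Multiplicative.ofAdd ((exists_hasParity hn g.2).choose_spec.unique hn ho g.2 h)

theorem exists_hasParity_one (hn : 2 ≤ n) : ∃ t ∈ V n, HasParity t 1 := by
  let z : Fin n := ⟨0, by omega⟩
  let o : Fin n := ⟨1, by omega⟩
  have hzo : z ≠ o := by simp [z, o]
  have hp : Perp [z] [o] := perp_of_length_eq rfl (by simpa using hzo)
  have hP := (isBasis_level n 1).pairwise_perp fun _ => z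
  have mz : [z] ∈ (level n 1 : Set (Word n)) := mem_level.2 rfl
  have mo : [o] ∈ (level n 1 : Set (Word n)) := mem_level.2 rfl
  obtain ⟨t, ht⟩ := exists_lifts hP (swap_fixes mz mo)
  refine ⟨t, ht.mem_V (Finset.finite_toSet _), level n 1, swap [z] [o], isBasis_level n 1,
    (lifts_iff.1 ht).1, ?_⟩
  let φ : Fin n → level n 1 := fun i => ⟨[i], mem_level.2 rfl⟩
  have hφ : Function.Bijective φ := by
    constructor
    · intro i j h
      have : [i] = [j] := congrArg Subtype.val h
      simpa using this
    · rintro ⟨v, hv⟩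
      obtain ⟨i, rfl⟩ := List.length_eq_one_iff.1 (mem_level.1 hv)
      exact ⟨i, rfl⟩
  rw [basisParity, ← invParity_comp _ _ (Equiv.ofBijective φ hφ), invParity]
  have hinj : Function.Injective fun i : Fin n => [i] := fun i j h => by simpa using h
  have h1 : ∀ i : Fin n, swap [z] [o] [i] = [swap z o i] := fun i => hinj.swap_apply z o i
  have h2 : ∀ i j : Fin n, ([i] : Word n) < [j] ↔ i < j := fun i j => by
    simp [List.cons_lt_cons_iff]
  -- Exchanging the two least letters inverts just this one pair.
  have h3 : ∀ i j : Fin n, (i < j ∧ swap z o j < swap z o i) ↔ i = z ∧ j = o := by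
    intro i j
    constructor
    · rintro ⟨h4, h5⟩
      rw [swap_apply_def, swap_apply_def] at h5
      split_ifs at h5 <;> simp only [z, o, Fin.lt_def, Fin.ext_iff] at * <;> omega
    · rintro ⟨rfl, rfl⟩
      rw [swap_apply_left, swap_apply_right]
      simp [z, o, Fin.lt_def]
  simp only [Function.comp_def, Equiv.ofBijective_apply, φ, h1, h2, h3]
  rw [Finset.sum_eq_single z, Finset.sum_eq_single o]
  · simp
  · intro j _ hj
    simp [hj]
  · simp
  · intro i _ hi
    simp [hi]
  · simp

theorem exists_ne_one_mem_derivedV (hn : 2 ≤ n) : ∃ h ∈ derivedV n, h ≠ 1 := by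
  obtain ⟨a, b, ha, hb, hab, -⟩ := exists_perp_pair hn ∅ (by simp) 3 (by simp)
  obtain ⟨c, c', -, -, -, hc⟩ := exists_perp_pair hn {a, b}
    (Finset.card_le_two.trans (by norm_num)) 3 (by simp [ha, hb])
  obtain ⟨h, hh, h1, -⟩ := (triIn_derivedV hab (hc b (by simp)).1 (hc a (by simp)).1).exists_sends
  refine ⟨h, hh, ?_⟩
  rintro rfl
  exact hab.ne ((sends_one _).unique hn h1)

/-- The words `0 … 0 1` form an infinite antichain, and below each of them two children can be
exchanged. -/
theorem infinite_V (hn : 2 ≤ n) : Infinite (V n) := by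
  let z : Fin n := ⟨0, by omega⟩
  let o : Fin n := ⟨1, by omega⟩
  have hzo : z ≠ o := by simp [z, o]
  let p : ℕ → Word n := fun k => List.replicate k z ++ [o]
  have hp : ∀ j k, j < k → Perp (p j) (p k) := by
    intro j k hjk
    obtain ⟨m, rfl⟩ := Nat.exists_eq_add_of_lt hjk
    have h1 : p (j + m + 1) = List.replicate j z ++ ([z] ++ (List.replicate m z ++ [o])) := by
      simp only [p]
      rw [← List.append_assoc, ← List.append_assoc, show j + m + 1 = j + 1 + m by ring,
        List.replicate_add, List.replicate_add]
      rfl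
    rw [h1]
    have h2 : Perp [o] [z] := perp_of_length_eq rfl (by simpa using hzo.symm)
    exact perp_append_left.2 (h2.mono (List.prefix_refl [o]) (List.prefix_append [z] _))
  have hp' : ∀ j k, j ≠ k → Perp (p j) (p k) := fun j k hjk => by
    rcases lt_or_gt_of_ne hjk with h | h
    exacts [hp j k h, (hp k j h).symm]
  have hq : ∀ k, Perp (p k ++ [z]) (p k ++ [o]) := fun k => perp_append_singleton hzo
  choose t ht hm using fun k => exists_moves_swap (hq k)
  refine Infinite.of_injective (fun k => (⟨t k, ht k⟩ : V n)) fun j k h => ?_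
  by_contra hjk
  have h' : t j = t k := congrArg Subtype.val h
  have h1 := (moves_two.1 (hm j)).1
  have h2 : Sends (t j) (p j ++ [z]) (p j ++ [z]) := by
    intro w
    rw [h', (moves_two.1 (hm k)).2.2]
    all_goals exact ((hp' j k hjk).mono (List.prefix_append _ _)
      (List.prefix_append _ _)).notMem_cone w
  exact (hq j).ne (h2.unique hn h1)

end Sign

/-! ### Generating pairs, noncyclicity and nonsimplicity -/

section Generation

variable {n : ℕ}

theorem map_closure_pair {G : Type*} [Group G] {G' : Type*} [Group G'] (φ : G →* G') (x y : G) :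
    (Subgroup.closure {x, y}).map φ = Subgroup.closure {φ x, φ y} := by
  rw [MonoidHom.map_closure, Set.image_pair]

theorem isThreeHalvesGenerated_of_exists {G : Type*} [Group G] [Nontrivial G]
    (h : ∀ g : G, g ≠ 1 → ∃ h : G, h ≠ g ∧ Subgroup.closure {g, h} = ⊤) :
    IsThreeHalvesGenerated G := by
  classical
  refine ⟨?_, h⟩
  obtain ⟨g, hg⟩ := exists_ne (1 : G)
  obtain ⟨k, hk, hc⟩ := h g hg
  exact ⟨{g, k}, Finset.card_pair hk.symm, by simpa using hc⟩

theorem exists_V (hn : 2 ≤ n) (g : V n) (hg : g ≠ 1) : ∃ h : V n, h ≠ g ∧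
    Subgroup.closure {g, h} = ⊤ ∧ IsOfFinOrder h ∧ IsCoprimeCycleProduct (h : Perm (Cantor n)) := by
  obtain ⟨h, hV, hne, hc, hf, -, -, hle⟩ := exists_coprimeCycleProduct hn g.2
    (fun h => hg (Subtype.ext h)) true
  refine ⟨⟨h, hV⟩, fun he => hne (congrArg Subtype.val he), ?_, ?_, hc⟩
  · rw [eq_top_iff]
    intro x _
    have hx := hle rfl x.2
    have h1 := map_closure_pair (V n).subtype g ⟨h, hV⟩
    simp only [Subgroup.coe_subtype] at h1
    rw [← h1] at hx
    obtain ⟨y, hy, hyx⟩ := hx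
    obtain rfl : y = x := Subtype.ext hyx
    exact hy
  · exact Submonoid.isOfFinOrder_coe.1 hf

theorem exists_commutator_V (hn : 2 ≤ n) (g : commutator (V n)) (hg : g ≠ 1) :
    ∃ h : commutator (V n), h ≠ g ∧ Subgroup.closure {g, h} = ⊤ ∧ IsOfFinOrder h ∧
      IsCoprimeCycleProduct ((h : V n) : Perm (Cantor n)) := by
  obtain ⟨h, hV, hne, hc, hf, hle, hd, -⟩ := exists_coprimeCycleProduct hn g.1.2
    (fun h => hg (Subtype.ext (Subtype.ext h))) false
  obtain ⟨k, hk, rfl⟩ := hd rfl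
  refine ⟨⟨k, hk⟩, fun he => hne (congrArg (fun x : commutator (V n) => ((x : V n) : Perm (Cantor n))) he), ?_, ?_, hc⟩
  · rw [eq_top_iff]
    intro x _
    have hx := hle ⟨x.1, x.2, rfl⟩
    have h1 := map_closure_pair ((V n).subtype.comp (commutator (V n)).subtype) g ⟨k, hk⟩
    simp only [MonoidHom.comp_apply, Subgroup.coe_subtype] at h1 hx
    rw [← h1] at hx
    obtain ⟨y, hy, hyx⟩ := hx
    obtain rfl : y = x := Subtype.ext (Subtype.ext hyx)
    exact hy
  · exact Submonoid.isOfFinOrder_coe.1 (Submonoid.isOfFinOrder_coe.1 hf)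

theorem exists_ne_one_mem_commutator (hn : 2 ≤ n) : ∃ k ∈ commutator (V n), k ≠ 1 := by
  obtain ⟨_, ⟨k, hk, rfl⟩, h1⟩ := exists_ne_one_mem_derivedV hn
  exact ⟨k, hk, by rintro rfl; exact h1 rfl⟩

theorem not_isCyclic_V (hn : 2 ≤ n) : ¬ IsCyclic (V n) := by
  intro h
  obtain ⟨k, hk, h1⟩ := exists_ne_one_mem_commutator hn
  let _ := h.commGroup
  have h2 : commutator (V n) ≤ (MonoidHom.id (V n)).ker := Abelianization.commutator_subset_ker _
  exact h1 (h2 hk)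

/-- The kernel of the sign contains a nontrivial commutator element and misses a transposition. -/
theorem not_isSimpleGroup_V (hn : 2 ≤ n) (ho : Odd n) : ¬ IsSimpleGroup (V n) := by
  intro h
  rcases h.eq_bot_or_eq_top_of_normal _ (MonoidHom.normal_ker (signHom hn ho)) with h1 | h1
  · obtain ⟨k, hk, hk1⟩ := exists_ne_one_mem_commutator hn
    have h2 := Abelianization.commutator_subset_ker (signHom hn ho) hk
    rw [h1] at h2
    exact hk1 h2
  · obtain ⟨t, ht, hp⟩ := exists_hasParity_one hn
    have h2 : (⟨t, ht⟩ : V n) ∈ (signHom hn ho).ker := h1 ▸ Subgroup.mem_top _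
    rw [MonoidHom.mem_ker, signHom_eq hn ho hp] at h2
    exact absurd (Multiplicative.ofAdd.injective h2) (by decide)

end Generation

end HigmanThompson

theorem theorem1 (n : ℕ) (hn : 2 ≤ n) :
    IsThreeHalvesGenerated (HigmanThompson.V n) ∧
    IsThreeHalvesGenerated (commutator (HigmanThompson.V n)) ∧
    (∀ g : HigmanThompson.V n, g ≠ 1 →
      ∃ h : HigmanThompson.V n, h ≠ g ∧ Subgroup.closure {g, h} = ⊤ ∧ IsOfFinOrder h ∧
        HigmanThompson.IsCoprimeCycleProduct (h : Equiv.Perm (HigmanThompson.Cantor n))) ∧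
    (∀ g : commutator (HigmanThompson.V n), g ≠ 1 →
      ∃ h : commutator (HigmanThompson.V n),
        h ≠ g ∧ Subgroup.closure {g, h} = ⊤ ∧ IsOfFinOrder h ∧
        HigmanThompson.IsCoprimeCycleProduct
          ((h : HigmanThompson.V n) : Equiv.Perm (HigmanThompson.Cantor n))) ∧
    (Odd n → Infinite (HigmanThompson.V n) ∧ ¬ IsCyclic (HigmanThompson.V n) ∧
      ¬ IsSimpleGroup (HigmanThompson.V n)) := by
  obtain ⟨k, hk, hk1⟩ := HigmanThompson.exists_ne_one_mem_commutator hn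
  have h1 : Nontrivial (HigmanThompson.V n) := ⟨k, 1, hk1⟩
  have h2 : Nontrivial (commutator (HigmanThompson.V n)) :=
    ⟨⟨k, hk⟩, 1, fun h => hk1 (congrArg Subtype.val h)⟩
  refine ⟨HigmanThompson.isThreeHalvesGenerated_of_exists ?_, HigmanThompson.isThreeHalvesGenerated_of_exists ?_,
    HigmanThompson.exists_V hn, HigmanThompson.exists_commutator_V hn, fun ho =>
    ⟨HigmanThompson.infinite_V hn, HigmanThompson.not_isCyclic_V hn,
      HigmanThompson.not_isSimpleGroup_V hn ho⟩⟩
  · intro g hg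
    obtain ⟨h, h1, h2, -⟩ := HigmanThompson.exists_V hn g hg
    exact ⟨h, h1, h2⟩
  · intro g hg
    obtain ⟨h, h1, h2, -⟩ := HigmanThompson.exists_commutator_V hn g hg
    exact ⟨h, h1, h2⟩
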